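/- Let $N\ge 5$ and let $\mu$ be a probability density on $\mathbb R^N$ (with respect to Lebesgue measure); write $d\mu=\mu\,dx$ and $L^2_\mu=L^2(\mathbb R^N,d\mu)$ (real or complex valued functions). Assume (H1) (i) $\mu\in H^1_{\rm loc}(\mathbb R^N)$ and $\frac{\nabla\mu}{\mu}\in L^r_{\rm loc}(\mathbb R^N,\mathbb R^N)$ for some $r>N$; (ii) $\inf_{K}\mu>0$ for every compact $K\subset\mathbb R^N$. Assume moreover that there is $R_1>0$ such that for every $\varepsilon>0$ there is $C_\varepsilon>0$ with $$\left|\frac{\nabla\mu}{\mu}\right|^2\le\frac{\varepsilon}{|x|^2}+C_\varepsilon\qquad\text{a.e. in } B_{R_1}=\{|x|<R_1\}.$$ Let $(L,D(L))$ be the closure in $L^2_\mu$ of the operator $L\varphi=\Delta\varphi+\frac{\nabla\mu}{\mu}\cdot\nabla\varphi$, $\varphi\in C_c^\infty(\mathbb R^N)$, let $\|u\|^2_{H^1_\mu}=\int_{\mathbb R^N}|u|^2d\mu+\int_{\mathbb R^N}|\nabla u|^2d\mu$ (with $\nabla u$ the weak gradient), and let $C_0=\left(\frac{N-2}{2}\right)^2$.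 Then $(C_0-1)^2=\left(\frac{N(N-4)}{4}\right)^2$, and if $c>(C_0-1)^2$, there is no constant $C>0$ such that $$c\int_{\mathbb R^N}\frac{|u(x)|^2}{|x|^4}\,d\mu\le\int_{\mathbb R^N}|Lu(x)|^2\,d\mu+C\|u\|^2_{H^1_\mu}\qquad\text{for all }u\in D(L).$$ -/

import Mathlib

open MeasureTheory Laplacian
open scoped ENNReal ContDiff

/-- `G` is the weak (distributional) gradient of the `𝕜`-valued function `u` on `ℝᴺ`: both are
locally integrable and `∫ u ∂ᵢφ dx = -∫ Gᵢ φ dx` for every test function `φ` and every `i`. -/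
structure HasWeakGradient {𝕜 : Type*} [RCLike 𝕜] {N : ℕ}
    (u : EuclideanSpace ℝ (Fin N) → 𝕜)
    (G : EuclideanSpace ℝ (Fin N) → EuclideanSpace 𝕜 (Fin N)) : Prop where
  locallyIntegrable : LocallyIntegrable u volume
  locallyIntegrable_grad : LocallyIntegrable G volume
  integral_eq : ∀ φ : EuclideanSpace ℝ (Fin N) → ℝ, ContDiff ℝ ∞ φ → HasCompactSupport φ →
    ∀ i : Fin N,
      ∫ x, (fderiv ℝ φ x (EuclideanSpace.single i 1)) • u x = -∫ x, φ x • G x i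

/-- The measure `dμ = ρ dx` with density `ρ` with respect to Lebesgue measure. -/
noncomputable def weightMeasure {N : ℕ} (ρ : EuclideanSpace ℝ (Fin N) → ℝ) :
    Measure (EuclideanSpace ℝ (Fin N)) :=
  volume.withDensity (fun x => ENNReal.ofReal (ρ x))

/-- `ρ` is a probability density on `ℝᴺ`. -/
structure IsProbDensity {N : ℕ} (ρ : EuclideanSpace ℝ (Fin N) → ℝ) : Prop where
  nonneg : ∀ᵐ x ∂(volume : Measure (EuclideanSpace ℝ (Fin N))), 0 ≤ ρ x
  integrable : Integrable ρ volume
  integral_eq_one : ∫ x, ρ x = 1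

/-- Hypothesis (H1) on the density `ρ`, whose weak gradient is `ρ'`: `ρ ∈ H¹_loc`,
`ρ' / ρ ∈ L^r_loc` for some `r > N`, and `ρ` is (essentially) bounded below by a positive constant
on every compact set. -/
structure HypothesisH1 {N : ℕ} (ρ : EuclideanSpace ℝ (Fin N) → ℝ)
    (ρ' : EuclideanSpace ℝ (Fin N) → EuclideanSpace ℝ (Fin N)) : Prop where
  hasWeakGradient : HasWeakGradient ρ ρ'
  memLp_two : ∀ K : Set (EuclideanSpace ℝ (Fin N)), IsCompact K →
    MemLp ρ 2 (volume.restrict K)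
  memLp_two_grad : ∀ K : Set (EuclideanSpace ℝ (Fin N)), IsCompact K →
    MemLp ρ' 2 (volume.restrict K)
  memLp_drift : ∃ r : ℝ, (N : ℝ) < r ∧ ∀ K : Set (EuclideanSpace ℝ (Fin N)), IsCompact K →
    MemLp (fun x => (ρ x)⁻¹ • ρ' x) (ENNReal.ofReal r) (volume.restrict K)
  lower_bound : ∀ K : Set (EuclideanSpace ℝ (Fin N)), IsCompact K →
    ∃ a : ℝ, 0 < a ∧ ∀ᵐ x ∂(volume.restrict K), a ≤ ρ x

/-- The expression `Lφ = Δφ + (∇ρ / ρ) · ∇φ` for a smooth function `φ`, where `ρ' = ∇ρ`. -/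
noncomputable def kolmogorovExpr {𝕜 : Type*} [RCLike 𝕜] {N : ℕ}
    (ρ : EuclideanSpace ℝ (Fin N) → ℝ)
    (ρ' : EuclideanSpace ℝ (Fin N) → EuclideanSpace ℝ (Fin N))
    (φ : EuclideanSpace ℝ (Fin N) → 𝕜) (x : EuclideanSpace ℝ (Fin N)) : 𝕜 :=
  Δ φ x + fderiv ℝ φ x ((ρ x)⁻¹ • ρ' x)

theorem kolmogorovExpr_add {𝕜 : Type*} [RCLike 𝕜] {N : ℕ}
    (ρ : EuclideanSpace ℝ (Fin N) → ℝ)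
    (ρ' : EuclideanSpace ℝ (Fin N) → EuclideanSpace ℝ (Fin N))
    {φ ψ : EuclideanSpace ℝ (Fin N) → 𝕜} (hφ : ContDiff ℝ ∞ φ) (hψ : ContDiff ℝ ∞ ψ) :
    kolmogorovExpr ρ ρ' (φ + ψ) = kolmogorovExpr ρ ρ' φ + kolmogorovExpr ρ ρ' ψ := by
  funext x
  have h1 : (∞ : WithTop ℕ∞) ≠ 0 := by simp
  simp only [kolmogorovExpr, Pi.add_apply]
  rw [(contDiff_infty.1 hφ 2).contDiffAt.laplacian_add (contDiff_infty.1 hψ 2).contDiffAt,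
    fderiv_add (hφ.differentiable h1 x) (hψ.differentiable h1 x),
    add_apply]
  ring

theorem kolmogorovExpr_smul {𝕜 : Type*} [RCLike 𝕜] {N : ℕ}
    (ρ : EuclideanSpace ℝ (Fin N) → ℝ)
    (ρ' : EuclideanSpace ℝ (Fin N) → EuclideanSpace ℝ (Fin N)) (a : 𝕜)
    {φ : EuclideanSpace ℝ (Fin N) → 𝕜} (hφ : ContDiff ℝ ∞ φ) :
    kolmogorovExpr ρ ρ' (a • φ) = a • kolmogorovExpr ρ ρ' φ := by
  funext x
  have h1 : (∞ : WithTop ℕ∞) ≠ 0 := by simp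
  simp only [kolmogorovExpr, Pi.smul_apply]
  rw [InnerProductSpace.laplacian_smul a (contDiff_infty.1 hφ 2).contDiffAt,
    fderiv_const_smul (hφ.differentiable h1 x), smul_apply, smul_add]

/-- The graph `{(φ, Lφ) : φ ∈ C_c^∞(ℝᴺ)}` in `L²_μ × L²_μ`, where `dμ = ρ dx`. -/
noncomputable def kolmogorovCoreGraph (𝕜 : Type*) [RCLike 𝕜] {N : ℕ}
    (ρ : EuclideanSpace ℝ (Fin N) → ℝ)
    (ρ' : EuclideanSpace ℝ (Fin N) → EuclideanSpace ℝ (Fin N)) :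
    Submodule 𝕜 (Lp 𝕜 2 (weightMeasure ρ) × Lp 𝕜 2 (weightMeasure ρ)) where
  carrier := {p | ∃ φ : EuclideanSpace ℝ (Fin N) → 𝕜, ContDiff ℝ ∞ φ ∧ HasCompactSupport φ ∧
    p.1 =ᵐ[weightMeasure ρ] φ ∧ p.2 =ᵐ[weightMeasure ρ] kolmogorovExpr ρ ρ' φ}
  zero_mem' := by
    refine ⟨0, contDiff_const, HasCompactSupport.zero, Lp.coeFn_zero _ _ _, ?_⟩
    have h := kolmogorovExpr_smul ρ ρ' (0 : 𝕜) (φ := 0) contDiff_const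
    rw [zero_smul, zero_smul] at h
    rw [h]
    exact Lp.coeFn_zero _ _ _
  add_mem' := by
    rintro p q ⟨φ, hφ, hφc, hp1, hp2⟩ ⟨ψ, hψ, hψc, hq1, hq2⟩
    refine ⟨φ + ψ, hφ.add hψ, hφc.add hψc, (Lp.coeFn_add _ _).trans (hp1.add hq1), ?_⟩
    rw [kolmogorovExpr_add ρ ρ' hφ hψ]
    exact (Lp.coeFn_add _ _).trans (hp2.add hq2)
  smul_mem' := by
    rintro a p ⟨φ, hφ, hφc, hp1, hp2⟩
    refine ⟨a • φ, contDiff_const.smul hφ, hφc.smul_left (f := fun _ => a),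
      (Lp.coeFn_smul _ _).trans (hp1.const_smul a), ?_⟩
    rw [kolmogorovExpr_smul ρ ρ' a hφ]
    exact (Lp.coeFn_smul _ _).trans (hp2.const_smul a)

/-- The Kolmogorov operator `(L, D(L))` on `L²_μ`, `dμ = ρ dx`: the closure of
`(L, C_c^∞(ℝᴺ))`. -/
noncomputable def kolmogorovOperator (𝕜 : Type*) [RCLike 𝕜] {N : ℕ}
    (ρ : EuclideanSpace ℝ (Fin N) → ℝ)
    (ρ' : EuclideanSpace ℝ (Fin N) → EuclideanSpace ℝ (Fin N)) :
    Lp 𝕜 2 (weightMeasure ρ) →ₗ.[𝕜] Lp 𝕜 2 (weightMeasure ρ) :=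
  (kolmogorovCoreGraph 𝕜 ρ ρ').toLinearPMap.closure

/-- The squared norm `‖u‖²_{H¹_μ} = ∫ |u|² dμ + ∫ |∇u|² dμ`, `dμ = ρ dx`, with value `∞` if `u` has
no weak gradient. The weak gradient is unique almost everywhere, so that the infimum below is over
a single class of functions. -/
noncomputable def weightedH1NormSq {𝕜 : Type*} [RCLike 𝕜] {N : ℕ}
    (ρ : EuclideanSpace ℝ (Fin N) → ℝ) (u : EuclideanSpace ℝ (Fin N) → 𝕜) : ℝ≥0∞ :=
  (∫⁻ x, ‖u x‖ₑ ^ 2 ∂(weightMeasure ρ)) +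
    ⨅ (G : EuclideanSpace ℝ (Fin N) → EuclideanSpace 𝕜 (Fin N)) (_ : HasWeakGradient u G),
      ∫⁻ x, ‖G x‖ₑ ^ 2 ∂(weightMeasure ρ)

/-- The constant `C₀ = ((N - 2) / 2)²` of Hardy's inequality. -/
noncomputable def hardyConst (N : ℕ) : ℝ := (((N : ℝ) - 2) / 2) ^ 2

/-- The weighted Rellich inequality with constant `c`: for some `C > 0` and all `u ∈ D(L)`,
`c ∫ |u|² / |x|⁴ dμ ≤ ∫ |Lu|² dμ + C ‖u‖²_{H¹_μ}`, where `dμ = ρ dx`. The integrals take values in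
`[0, ∞]`. -/
def WeightedRellich (𝕜 : Type*) [RCLike 𝕜] {N : ℕ}
    (ρ : EuclideanSpace ℝ (Fin N) → ℝ)
    (ρ' : EuclideanSpace ℝ (Fin N) → EuclideanSpace ℝ (Fin N)) (c : ℝ) : Prop :=
  ∃ C : ℝ, 0 < C ∧ ∀ u : (kolmogorovOperator 𝕜 ρ ρ').domain,
    ENNReal.ofReal c *
        ∫⁻ x, ‖(u : Lp 𝕜 2 (weightMeasure ρ)) x‖ₑ ^ 2 / ‖x‖ₑ ^ 4 ∂(weightMeasure ρ) ≤
      (∫⁻ x, ‖(kolmogorovOperator 𝕜 ρ ρ' u) x‖ₑ ^ 2 ∂(weightMeasure ρ)) +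
        ENNReal.ofReal C * weightedH1NormSq ρ (u : Lp 𝕜 2 (weightMeasure ρ))

/-! The inequality is tested on `u(x) = |x|^α f(log |x|)` with `α = -(N-4)/2`, where `f` is
supported far out towards `-∞`. Put `t = log |x|` and let `ν` be the image of `|x|^(-N) μ` on the
line. The exponent is such that `∫ |u|²/|x|⁴ dμ = ∫ f² dν` and `|x|^(N/2) Δu = f'' + 2f' - A f`,
where `A = N(N-4)/4 = C₀ - 1`. By the drift assumption `|x| |∇μ/μ| ≤ η` near the origin, so the
drift adds at most `η |f' + α f|`. The `H¹_μ` norm carries extra weights `e^(4t)` and `e^(2t)`,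
which are small on the support of `f`, whatever `C` is.

If `f'` and `f''` are small in `L²(ν)` compared with `f`, the right-hand side is therefore at most
about `A² ∫ f² dν`, which contradicts `c > A²` as soon as `∫ f² dν > 0`.

For Lebesgue measure such an `f` is a wide plateau. Here the mass of `ν` near the edges of the
plateau must be controlled by the mass on it. The bound `|x| |∇μ/μ| ≤ η` says, through the
divergence theorem for fields `w(log |x|) x`, that the logarithmic derivative of `ν` is at most `η`
in the weak sense (`IsProbDensity.slowlyVarying_logMeasure`). Hence translates of a bump have
comparable integrals (`SlowlyVarying.integral_shift_le`), and
`exists_test_function_small_derivatives` follows once `η` is small compared with the inverse width.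
`rellich_inequality_logMeasure` and `integral_rellich_le` give the two sides of the contradiction.
-/

/-! ### Calculus of functions of log ‖x‖. -/

theorem exp_neg_two_mul_log {r : ℝ} (hr : 0 < r) : Real.exp (-2 * Real.log r) = (r ^ 2)⁻¹ := by
  rw [neg_mul, Real.exp_neg, mul_comm, Real.exp_mul, Real.exp_log hr]
  norm_num

/-- A smooth function on the real line which vanishes outside `[a, b]`. -/
structure SmoothSupportedOn (h : ℝ → ℝ) (a b : ℝ) : Prop where
  contDiff : ContDiff ℝ ∞ h
  eq_zero : ∀ t, t ∉ Set.Icc a b → h t = 0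

namespace SmoothSupportedOn

variable {h : ℝ → ℝ} {a b : ℝ}

theorem hasCompactSupport (hh : SmoothSupportedOn h a b) : HasCompactSupport h :=
  HasCompactSupport.intro isCompact_Icc hh.eq_zero

theorem hasDerivAt (hh : SmoothSupportedOn h a b) (t : ℝ) : HasDerivAt h (deriv h t) t :=
  (hh.contDiff.differentiable (by simp) t).hasDerivAt

protected theorem deriv (hh : SmoothSupportedOn h a b) : SmoothSupportedOn (deriv h) a b where
  contDiff := (contDiff_infty_iff_deriv.1 hh.contDiff).2
  eq_zero t ht := by
    have : h =ᶠ[nhds t] fun _ => (0 : ℝ) := by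
      filter_upwards [isClosed_Icc.isOpen_compl.mem_nhds ht] with s hs using hh.eq_zero s hs
    rw [this.deriv_eq, deriv_const]

theorem smul (hh : SmoothSupportedOn h a b) {k : ℝ → ℝ} (hk : ContDiff ℝ ∞ k) :
    SmoothSupportedOn (fun t => k t * h t) a b where
  contDiff := hk.mul hh.contDiff
  eq_zero t ht := by simp [hh.eq_zero t ht]

theorem mono (hh : SmoothSupportedOn h a b) {a' b' : ℝ} (ha : a' ≤ a) (hb : b ≤ b') :
    SmoothSupportedOn h a' b' where
  contDiff := hh.contDiff
  eq_zero t ht := hh.eq_zero t fun h => ht (Set.Icc_subset_Icc ha hb h)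

theorem add (hh : SmoothSupportedOn h a b) {k : ℝ → ℝ} (hk : SmoothSupportedOn k a b) :
    SmoothSupportedOn (fun t => h t + k t) a b where
  contDiff := hh.contDiff.add hk.contDiff
  eq_zero t ht := by simp [hh.eq_zero t ht, hk.eq_zero t ht]

section Radial

variable {E : Type*} [NormedAddCommGroup E] [InnerProductSpace ℝ E]

/-- At the origin, a function of `log ‖x‖` supported in `[a, b]` with `b < 0` vanishes; this takes
the convention `Real.log 0 = 0` into account. -/
theorem eventually_zero {E : Type*} [NormedAddCommGroup E] (hh : SmoothSupportedOn h a b)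
    (hb : b < 0) :
    (fun x : E => h (Real.log ‖x‖)) =ᶠ[nhds 0] fun _ => 0 := by
  filter_upwards [Metric.ball_mem_nhds (0 : E) (Real.exp_pos a)] with x hx
  apply hh.eq_zero
  rintro ⟨h1, h2⟩
  rcases eq_or_ne x 0 with rfl | hx0
  · simp at h2
    linarith
  · rw [mem_ball_zero_iff, ← Real.log_lt_iff_lt_exp (norm_pos_iff.2 hx0)] at hx
    linarith

theorem zero_apply (hh : SmoothSupportedOn h a b) (hb : b < 0) : h 0 = 0 :=
  hh.eq_zero 0 fun h => absurd h.2 (not_le.2 hb)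

theorem contDiff_radial (hh : SmoothSupportedOn h a b) (hb : b < 0) :
    ContDiff ℝ ∞ (fun x : E => h (Real.log ‖x‖)) := by
  rw [contDiff_iff_contDiffAt]
  intro x
  rcases eq_or_ne x 0 with rfl | hx
  · exact contDiffAt_const.congr_of_eventuallyEq (hh.eventually_zero hb)
  · exact hh.contDiff.contDiffAt.comp x ((contDiffAt_norm ℝ hx).log (norm_ne_zero_iff.2 hx))

theorem hasCompactSupport_radial [FiniteDimensional ℝ E] (hh : SmoothSupportedOn h a b)
    (hb : b < 0) : HasCompactSupport (fun x : E => h (Real.log ‖x‖)) := by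
  refine HasCompactSupport.intro (isCompact_closedBall (0 : E) 1) fun x hx => hh.eq_zero _ ?_
  rw [mem_closedBall_zero_iff, not_le] at hx
  intro h'
  have := Real.log_pos hx
  linarith [h'.2]

/-- The gradient of `log ‖x‖` is `x/‖x‖²`. Writing `‖x‖⁻²` as an exponential of `log ‖x‖` keeps the
gradient in the form `k (log ‖x‖) x` with `k` supported in `[a, b]`, so that the computation can be
iterated, also at the origin. -/
theorem hasFDerivAt_radial (hh : SmoothSupportedOn h a b) (hb : b < 0) (x : E) :
    HasFDerivAt (fun x : E => h (Real.log ‖x‖))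
      ((Real.exp (-2 * Real.log ‖x‖) * deriv h (Real.log ‖x‖)) • innerSL ℝ x) x := by
  rcases eq_or_ne x 0 with rfl | hx
  · have h0 : deriv h 0 = 0 := hh.deriv.zero_apply hb
    simp only [norm_zero, Real.log_zero, h0, mul_zero, zero_smul]
    exact (hasFDerivAt_const (0 : ℝ) (0 : E)).congr_of_eventuallyEq (hh.eventually_zero hb)
  · have hn : (0 : ℝ) < ‖x‖ := norm_pos_iff.2 hx
    have h1 : HasFDerivAt (fun x : E => Real.log (‖x‖ ^ 2))
        ((‖x‖ ^ 2)⁻¹ • ((2 : ℝ) • innerSL ℝ x)) x := by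
      refine ((hasStrictFDerivAt_norm_sq x).hasFDerivAt.log (pow_pos hn 2).ne').congr_fderiv ?_
      ext v
      simp [two_mul]
    have h2 : HasFDerivAt (fun x : E => Real.log ‖x‖) ((‖x‖ ^ 2)⁻¹ • innerSL ℝ x) x := by
      have h3 : (fun x : E => Real.log ‖x‖) = fun x => 2⁻¹ * Real.log (‖x‖ ^ 2) := by
        ext y
        rw [Real.log_pow]
        push_cast
        ring
      rw [h3]
      refine (h1.const_mul (2⁻¹ : ℝ)).congr_fderiv ?_
      ext v
      simp
      ring
    refine ((hh.hasDerivAt (Real.log ‖x‖)).comp_hasFDerivAt x h2).congr_fderiv ?_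
    rw [exp_neg_two_mul_log hn, smul_smul, mul_comm]

end Radial

section Coordinates

variable {N : ℕ}

theorem hasFDerivAt_coord_mul_radial (hh : SmoothSupportedOn h a b) (hb : b < 0) (i : Fin N)
    (x : EuclideanSpace ℝ (Fin N)) :
    HasFDerivAt (fun x : EuclideanSpace ℝ (Fin N) => x i * h (Real.log ‖x‖))
      (x i • ((Real.exp (-2 * Real.log ‖x‖) * deriv h (Real.log ‖x‖)) • innerSL ℝ x) +
        h (Real.log ‖x‖) • EuclideanSpace.proj i) x :=
  ((EuclideanSpace.proj (𝕜 := ℝ) i : EuclideanSpace ℝ (Fin N) →L[ℝ] ℝ).hasFDerivAt (x := x)).mul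
    (hh.hasFDerivAt_radial hb x)

/-- The divergence of the vector field `x ↦ h (log ‖x‖) x`. -/
theorem sum_fderiv_coord_mul_radial (hh : SmoothSupportedOn h a b) (hb : b < 0)
    (x : EuclideanSpace ℝ (Fin N)) :
    ∑ i : Fin N, fderiv ℝ (fun x : EuclideanSpace ℝ (Fin N) => x i * h (Real.log ‖x‖)) x
      (EuclideanSpace.single i 1) =
    N * h (Real.log ‖x‖) + deriv h (Real.log ‖x‖) := by
  have key : ∀ i : Fin N, fderiv ℝ (fun x : EuclideanSpace ℝ (Fin N) => x i * h (Real.log ‖x‖)) x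
      (EuclideanSpace.single i 1) = (Real.exp (-2 * Real.log ‖x‖) * deriv h (Real.log ‖x‖)) *
        x i ^ 2 + h (Real.log ‖x‖) := by
    intro i
    rw [(hh.hasFDerivAt_coord_mul_radial hb i x).fderiv]
    simp [EuclideanSpace.inner_single_right]
    ring
  simp only [key, Finset.sum_add_distrib, ← Finset.mul_sum, Finset.sum_const, Finset.card_univ,
    Fintype.card_fin, nsmul_eq_mul]
  have h2 : ∑ i, x i ^ 2 = ‖x‖ ^ 2 := by
    rw [EuclideanSpace.norm_sq_eq]
    simp
  rw [h2, add_comm]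
  congr 1
  rcases eq_or_ne x 0 with rfl | hx
  · simp [hh.deriv.zero_apply hb]
  · have hn : (0 : ℝ) < ‖x‖ := norm_pos_iff.2 hx
    rw [exp_neg_two_mul_log hn]
    field_simp

theorem fderiv_radial_single (hh : SmoothSupportedOn h a b) (hb : b < 0)
    (x : EuclideanSpace ℝ (Fin N)) (i : Fin N) :
    fderiv ℝ (fun x : EuclideanSpace ℝ (Fin N) => h (Real.log ‖x‖)) x
      (EuclideanSpace.single i 1) =
      x i * (fun t => Real.exp (-2 * t) * deriv h t) (Real.log ‖x‖) := by
  rw [(hh.hasFDerivAt_radial hb x).fderiv]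
  simp [EuclideanSpace.inner_single_right]
  ring

theorem expMul (hh : SmoothSupportedOn h a b) (c : ℝ) :
    SmoothSupportedOn (fun t => Real.exp (c * t) * h t) a b :=
  hh.smul (Real.contDiff_exp.comp (contDiff_const.mul contDiff_id))

theorem deriv_expMul (hh : SmoothSupportedOn h a b) (c t : ℝ) :
    deriv (fun t => Real.exp (c * t) * h t) t =
      Real.exp (c * t) * (deriv h t + c * h t) := by
  have h1 : HasDerivAt (fun t : ℝ => Real.exp (c * t)) (Real.exp (c * t) * c) t := by
    simpa using ((hasDerivAt_id t).const_mul c).exp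
  have h2 : HasDerivAt (fun t => Real.exp (c * t) * h t) _ t := h1.mul (hh.hasDerivAt t)
  rw [h2.deriv]
  ring

/-- The gradient is the field `k (log ‖x‖) x` with `k = e^(-2t) h'`, and its divergence is `N k +
k'`; differentiating the exponential turns `N` into `N - 2`. -/
theorem laplacian_radial (hh : SmoothSupportedOn h a b) (hb : b < 0)
    (x : EuclideanSpace ℝ (Fin N)) :
    Δ (fun x : EuclideanSpace ℝ (Fin N) => h (Real.log ‖x‖)) x =
      Real.exp (-2 * Real.log ‖x‖) * (deriv (deriv h) (Real.log ‖x‖) +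
        (N - 2) * deriv h (Real.log ‖x‖)) := by
  rw [InnerProductSpace.laplacian_eq_iteratedFDeriv_orthonormalBasis _
    (EuclideanSpace.basisFun (Fin N) ℝ)]
  have hs : ContDiff ℝ ∞ (fun x : EuclideanSpace ℝ (Fin N) => h (Real.log ‖x‖)) :=
    hh.contDiff_radial hb
  have h2 : ∀ i : Fin N, iteratedFDeriv ℝ 2
      (fun x : EuclideanSpace ℝ (Fin N) => h (Real.log ‖x‖)) x
      ![EuclideanSpace.basisFun (Fin N) ℝ i, EuclideanSpace.basisFun (Fin N) ℝ i] =
      fderiv ℝ (fun x : EuclideanSpace ℝ (Fin N) => x i *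
        (fun t => Real.exp (-2 * t) * deriv h t) (Real.log ‖x‖)) x
        (EuclideanSpace.single i 1) := by
    intro i
    rw [iteratedFDeriv_two_apply]
    simp only [← hh.fderiv_radial_single hb]
    rw [fderiv_clm_apply _ (differentiableAt_const _)]
    · simp
    · exact ((contDiff_infty_iff_fderiv.1 hs).2.differentiable (by simp)) x
  simp only [h2]
  rw [(hh.deriv.expMul (-2)).sum_fderiv_coord_mul_radial hb, hh.deriv.deriv_expMul]
  ring

end Coordinates

end SmoothSupportedOn

/-! ### Slowly varying measures on the line. -/

/-- The measure `ν` on the line is slowly varying with rate `η` on `(-∞, b]`: in the weak sense, its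
logarithmic derivative is at most `η` in absolute value. -/
def SlowlyVarying (ν : Measure ℝ) (η b : ℝ) : Prop :=
  ∀ (ψ : ℝ → ℝ) (a : ℝ), SmoothSupportedOn ψ a b → |∫ t, deriv ψ t ∂ν| ≤ η * ∫ t, |ψ t| ∂ν

theorem SmoothSupportedOn.integrable {h : ℝ → ℝ} {a b : ℝ} (hh : SmoothSupportedOn h a b)
    (ν : Measure ℝ) [IsFiniteMeasureOnCompacts ν] : Integrable h ν :=
  hh.contDiff.continuous.integrable_of_hasCompactSupport hh.hasCompactSupport

section Compare

variable {ν : Measure ℝ} [IsFiniteMeasureOnCompacts ν] {η a b : ℝ}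

/-- A weak form of "`e^(ηt) ν` is nondecreasing": with the test function `e^(ηt) g`, the term `η
e^(ηt) g` cancels the bound. -/
theorem SlowlyVarying.integral_exp_mul_deriv_nonpos (hν : SlowlyVarying ν η b) {g : ℝ → ℝ}
    (hg : SmoothSupportedOn g a b) (hg0 : ∀ t, 0 ≤ g t) :
    ∫ t, Real.exp (η * t) * deriv g t ∂ν ≤ 0 := by
  have h := hν _ a (hg.expMul η)
  have h1 : ∀ t, |Real.exp (η * t) * g t| = Real.exp (η * t) * g t := fun t =>
    abs_of_nonneg (mul_nonneg (Real.exp_pos _).le (hg0 t))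
  simp only [h1, hg.deriv_expMul, mul_add] at h
  rw [integral_add ((hg.deriv.expMul η).integrable ν)
    (by simpa only [mul_left_comm] using ((hg.expMul η).integrable ν).const_mul η)] at h
  simp only [mul_left_comm _ η, integral_const_mul] at h
  linarith [(abs_le.1 h).2]

/-- Likewise, a weak form of "`e^(-ηt) ν` is nonincreasing". -/
theorem SlowlyVarying.integral_exp_mul_deriv_nonneg (hν : SlowlyVarying ν η b) {g : ℝ → ℝ}
    (hg : SmoothSupportedOn g a b) (hg0 : ∀ t, 0 ≤ g t) :
    0 ≤ ∫ t, Real.exp (-η * t) * deriv g t ∂ν := by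
  have h := hν _ a (hg.expMul (-η))
  have h1 : ∀ t, |Real.exp (-η * t) * g t| = Real.exp (-η * t) * g t := fun t =>
    abs_of_nonneg (mul_nonneg (Real.exp_pos _).le (hg0 t))
  simp only [h1, hg.deriv_expMul, mul_add] at h
  rw [integral_add ((hg.deriv.expMul (-η)).integrable ν)
    (by simpa only [mul_left_comm] using ((hg.expMul (-η)).integrable ν).const_mul (-η))] at h
  simp only [mul_left_comm _ (-η), integral_const_mul] at h
  linarith [(abs_le.1 h).1]

/-- The difference of two translates of a nonnegative bump is the derivative of a nonnegative
function with compact support. -/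
theorem exists_primitive_shift_sub {θ : ℝ → ℝ} {r : ℝ} (hθ : SmoothSupportedOn θ (-r) r)
    (hθ0 : ∀ t, 0 ≤ θ t) {c₁ c₂ : ℝ} (hc : c₁ ≤ c₂) :
    ∃ g : ℝ → ℝ, SmoothSupportedOn g (c₁ - r) (c₂ + r) ∧ (∀ t, 0 ≤ g t) ∧
      ∀ t, deriv g t = θ (t - c₁) - θ (t - c₂) := by
  set Θ : ℝ → ℝ := fun t => ∫ s in (0 : ℝ)..t, θ s with hΘ
  have hd : ∀ t, HasDerivAt Θ (θ t) t := fun t =>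
    intervalIntegral.integral_hasDerivAt_right (hθ.contDiff.continuous.intervalIntegrable _ _)
      (hθ.contDiff.continuous.stronglyMeasurableAtFilter _ _) hθ.contDiff.continuous.continuousAt
  have hΘs : ContDiff ℝ ∞ Θ := by
    rw [contDiff_infty_iff_deriv]
    refine ⟨fun t => (hd t).differentiableAt, ?_⟩
    rw [show deriv Θ = θ from funext fun t => (hd t).deriv]
    exact hθ.contDiff
  have hsub : ∀ x y, Θ x - Θ y = ∫ s in y..x, θ s := fun x y =>
    intervalIntegral.integral_interval_sub_left
      (hθ.contDiff.continuous.intervalIntegrable _ _)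
      (hθ.contDiff.continuous.intervalIntegrable _ _)
  -- This is the integral of `θ` over `[t - c₂, t - c₁]`: nonnegative, and zero once that interval
  -- misses the support of `θ`.
  refine ⟨fun t => Θ (t - c₁) - Θ (t - c₂), ⟨?_, ?_⟩, ?_, ?_⟩
  · exact (hΘs.comp (contDiff_id.sub contDiff_const)).sub
      (hΘs.comp (contDiff_id.sub contDiff_const))
  · intro t ht
    rw [hsub, intervalIntegral.integral_congr (g := fun _ => (0 : ℝ)),
      intervalIntegral.integral_zero]
    intro s hs
    rw [Set.uIcc_of_le (by linarith)] at hs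
    refine hθ.eq_zero s fun h => ht ?_
    constructor <;> linarith [h.1, h.2, hs.1, hs.2]
  · intro t
    change 0 ≤ Θ (t - c₁) - Θ (t - c₂)
    rw [hsub]
    exact intervalIntegral.integral_nonneg (by linarith) fun s _ => hθ0 s
  · intro t
    exact (((hd (t - c₁)).comp_sub_const t c₁).sub ((hd (t - c₂)).comp_sub_const t c₂)).deriv

theorem SmoothSupportedOn.shift {θ : ℝ → ℝ} {r : ℝ} (hθ : SmoothSupportedOn θ (-r) r) (c : ℝ) :
    SmoothSupportedOn (fun t => θ (t - c)) (c - r) (c + r) where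
  contDiff := hθ.contDiff.comp (contDiff_id.sub contDiff_const)
  eq_zero t ht := hθ.eq_zero _ fun h => ht ⟨by linarith [h.1], by linarith [h.2]⟩

/-- Translates of a bump have comparable integrals with respect to a slowly varying measure. -/
theorem SlowlyVarying.integral_shift_le (hη : 0 ≤ η) (hν : SlowlyVarying ν η b) {θ : ℝ → ℝ} {r : ℝ}
    (hθ : SmoothSupportedOn θ (-r) r) (hθ0 : ∀ t, 0 ≤ θ t) {c₁ c₂ : ℝ}
    (h₁ : c₁ + r ≤ b) (h₂ : c₂ + r ≤ b) :
    ∫ t, θ (t - c₁) ∂ν ≤ Real.exp (η * (|c₁ - c₂| + 2 * r)) * ∫ t, θ (t - c₂) ∂ν := by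
  have hI : ∀ k c, Integrable (fun t => Real.exp (k * t) * θ (t - c)) ν := fun k c =>
    ((hθ.shift c).expMul k).integrable ν
  have hI0 : ∀ c, Integrable (fun t => θ (t - c)) ν := fun c => (hθ.shift c).integrable ν
  have hz : ∀ c t, t ∉ Set.Icc (c - r) (c + r) → θ (t - c) = 0 := fun c => (hθ.shift c).eq_zero
  -- The weight `e^(kt)` is removed by bounding it below on the support of the first bump and above
  -- on that of the second. The sign of `k = ±η` depends on the order of the centres.
  have key : ∀ k m M : ℝ, (∀ t ∈ Set.Icc (c₁ - r) (c₁ + r), m ≤ k * t) →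
      (∀ t ∈ Set.Icc (c₂ - r) (c₂ + r), k * t ≤ M) →
      ∫ t, Real.exp (k * t) * θ (t - c₁) ∂ν ≤ ∫ t, Real.exp (k * t) * θ (t - c₂) ∂ν →
      ∫ t, θ (t - c₁) ∂ν ≤ Real.exp (M - m) * ∫ t, θ (t - c₂) ∂ν := by
    intro k m M hm hM hle
    have e1 : Real.exp m * ∫ t, θ (t - c₁) ∂ν ≤ ∫ t, Real.exp (k * t) * θ (t - c₁) ∂ν := by
      rw [← integral_const_mul]
      refine integral_mono ((hI0 c₁).const_mul _) (hI k c₁) fun t => ?_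
      by_cases ht : t ∈ Set.Icc (c₁ - r) (c₁ + r)
      · exact mul_le_mul_of_nonneg_right (Real.exp_le_exp.2 (hm t ht)) (hθ0 _)
      · simp [hz _ _ ht]
    have e2 : ∫ t, Real.exp (k * t) * θ (t - c₂) ∂ν ≤ Real.exp M * ∫ t, θ (t - c₂) ∂ν := by
      rw [← integral_const_mul]
      refine integral_mono (hI k c₂) ((hI0 c₂).const_mul _) fun t => ?_
      by_cases ht : t ∈ Set.Icc (c₂ - r) (c₂ + r)
      · exact mul_le_mul_of_nonneg_right (Real.exp_le_exp.2 (hM t ht)) (hθ0 _)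
      · simp [hz _ _ ht]
    rw [Real.exp_sub, div_mul_eq_mul_div, le_div_iff₀ (Real.exp_pos m), mul_comm]
    exact e1.trans (hle.trans e2)
  rcases le_total c₁ c₂ with hc | hc
  · obtain ⟨g, hg, hg0, hgd⟩ := exists_primitive_shift_sub hθ hθ0 hc
    have h := hν.integral_exp_mul_deriv_nonpos (hg.mono le_rfl h₂) hg0
    simp only [hgd, mul_sub] at h
    rw [integral_sub (hI _ _) (hI _ _)] at h
    refine (key η (η * (c₁ - r)) (η * (c₂ + r))
      (fun t ht => mul_le_mul_of_nonneg_left ht.1 hη)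
      (fun t ht => mul_le_mul_of_nonneg_left ht.2 hη) (by linarith)).trans_eq ?_
    rw [abs_of_nonpos (by linarith)]
    ring_nf
  · obtain ⟨g, hg, hg0, hgd⟩ := exists_primitive_shift_sub hθ hθ0 hc
    have h := hν.integral_exp_mul_deriv_nonneg (hg.mono le_rfl h₁) hg0
    simp only [hgd, mul_sub] at h
    rw [integral_sub (hI _ _) (hI _ _)] at h
    refine (key (-η) (-η * (c₁ + r)) (-η * (c₂ - r))
      (fun t ht => mul_le_mul_of_nonpos_left ht.2 (by linarith))
      (fun t ht => mul_le_mul_of_nonpos_left ht.1 (by linarith)) (by linarith)).trans_eq ?_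
    rw [abs_of_nonneg (by linarith)]
    ring_nf

end Compare

/-! ### A plateau function with small derivatives. -/

theorem HasCompactSupport.exists_abs_le {f : ℝ → ℝ} (hf : HasCompactSupport f)
    (hc : Continuous f) : ∃ K, ∀ t, |f t| ≤ K :=
  hf.exists_bound_of_continuous hc

/-- A smooth bump function of the line, equal to `1` on `[-1, 1]`. -/
theorem exists_smooth_bump : ∃ χ : ℝ → ℝ, SmoothSupportedOn χ (-2) 2 ∧ (∀ t, 0 ≤ χ t) ∧
    (∀ t, χ t ≤ 1) ∧ ∀ t, |t| ≤ 1 → χ t = 1 := by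
  let χ : ContDiffBump (0 : ℝ) := ⟨1, 2, one_pos, one_lt_two⟩
  refine ⟨χ, ⟨χ.contDiff, fun t ht => χ.zero_of_le_dist ?_⟩, fun t => χ.nonneg,
    fun _ => χ.le_one, fun t ht =>
    χ.one_of_mem_closedBall (by simpa [χ] using ht)⟩
  simp only [χ, Real.dist_eq, sub_zero]
  by_contra! h
  exact ht (abs_le.1 h.le)

theorem SmoothSupportedOn.dilate {h : ℝ → ℝ} {a b L : ℝ} (hh : SmoothSupportedOn h a b)
    (hL : 0 < L) : SmoothSupportedOn (fun t => h (t / L)) (a * L) (b * L) where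
  contDiff := hh.contDiff.comp (contDiff_id.div_const L)
  eq_zero _ ht := hh.eq_zero _ fun h' => ht
    ⟨(le_div_iff₀ hL).1 h'.1, (div_le_iff₀ hL).1 h'.2⟩

/-- If `ν` varies slowly enough near `-∞`, then there is a test function whose derivatives are small
compared with the function in `L²(ν)`. -/
theorem exists_test_function_small_derivatives {δ : ℝ} (hδ : 0 < δ) :
    ∃ η : ℝ, 0 < η ∧ η ≤ δ ∧ ∀ (ν : Measure ℝ) [IsFiniteMeasureOnCompacts ν] (b : ℝ),
      SlowlyVarying ν η b → ∃ (f : ℝ → ℝ) (a : ℝ), SmoothSupportedOn f a b ∧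
        (∃ t, f t ≠ 0) ∧
        ∫ t, (deriv f t ^ 2 + deriv (deriv f) t ^ 2) ∂ν ≤ δ * ∫ t, f t ^ 2 ∂ν := by
  obtain ⟨χ, hχ, hχ0, hχle, hχ1⟩ := exists_smooth_bump
  obtain ⟨K₁, hK₁⟩ := hχ.deriv.hasCompactSupport.exists_abs_le hχ.deriv.contDiff.continuous
  obtain ⟨K₂, hK₂⟩ :=
    hχ.deriv.deriv.hasCompactSupport.exists_abs_le hχ.deriv.deriv.contDiff.continuous
  set B : ℝ := K₁ ^ 2 + K₂ ^ 2 with hB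
  have hB0 : 0 ≤ B := by positivity
  -- `L` is the width scale: `f'² + f''² ≤ B/L` (using `L ≥ 1`), and the two edges each cost a
  -- factor `3`, whence `6 * B / L ≤ δ`.
  obtain ⟨L, hL1, hL⟩ : ∃ L : ℝ, 1 ≤ L ∧ 6 * B ≤ δ * L := by
    refine ⟨max 1 (6 * B / δ), le_max_left _ _, ?_⟩
    have := le_max_right 1 (6 * B / δ)
    rwa [div_le_iff₀' hδ] at this
  have hL0 : 0 < L := by linarith
  -- The bumps compared below have radius `L` and centres `3L/2` apart, so the exponent is `η (3L/2
  -- + 2L) ≤ 7/8`, and `e < 3`.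
  refine ⟨min δ (1 / (4 * L)), lt_min hδ (by positivity), min_le_left _ _, ?_⟩
  intro ν _ b hν
  set η := min δ (1 / (4 * L)) with hη
  have hη0 : 0 ≤ η := (lt_min hδ (by positivity)).le
  have hηL : η * (4 * L) ≤ 1 := by
    have := min_le_right δ (1 / (4 * L))
    rwa [le_div_iff₀ (by positivity)] at this
  -- All bumps used lie to the left of `b`: the rightmost ends at `s + 5L/2`.
  set s : ℝ := b - 3 * L with hs
  set f : ℝ → ℝ := fun t => χ ((t - s) / L) with hf
  have hfs : SmoothSupportedOn f (s - 2 * L) (s + 2 * L) := by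
    refine SmoothSupportedOn.shift (θ := fun t => χ (t / L)) ?_ s
    simpa using hχ.dilate hL0
  have hθ : SmoothSupportedOn (fun t => χ (t / (L / 2))) (-L) L := by
    convert hχ.dilate (half_pos hL0) using 1 <;> ring
  have hd1 : ∀ t, HasDerivAt f (deriv χ ((t - s) / L) / L) t := by
    intro t
    have h1 : HasDerivAt (fun t => (t - s) / L) (1 / L) t :=
      ((hasDerivAt_id t).sub_const s).div_const L
    have := (hχ.hasDerivAt ((t - s) / L)).comp t h1
    rw [mul_one_div] at this
    exact this
  have hd1' : deriv f = fun t => deriv χ ((t - s) / L) / L := funext fun t => (hd1 t).deriv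
  have hd2 : ∀ t, HasDerivAt (deriv f) (deriv (deriv χ) ((t - s) / L) / L / L) t := by
    intro t
    rw [hd1']
    have h1 : HasDerivAt (fun t => (t - s) / L) (1 / L) t :=
      ((hasDerivAt_id t).sub_const s).div_const L
    have := (hχ.deriv.hasDerivAt ((t - s) / L)).comp t h1
    rw [mul_one_div] at this
    exact this.div_const L
  have hflat : ∀ t, |t - s| < L → deriv f t = 0 ∧ deriv (deriv f) t = 0 := by
    have hnear : ∀ t, |t - s| < L → deriv f t = 0 := by
      intro t ht
      have : f =ᶠ[nhds t] fun _ => (1 : ℝ) := by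
        have ho : IsOpen {t : ℝ | |t - s| < L} := isOpen_lt (by fun_prop) continuous_const
        filter_upwards [ho.mem_nhds ht] with u hu
        apply hχ1
        rw [abs_div, abs_of_pos hL0, div_le_one hL0]
        exact le_of_lt hu
      rw [this.deriv_eq, deriv_const]
    intro t ht
    refine ⟨hnear t ht, ?_⟩
    have : deriv f =ᶠ[nhds t] fun _ => (0 : ℝ) := by
      have ho : IsOpen {t : ℝ | |t - s| < L} := isOpen_lt (by fun_prop) continuous_const
      filter_upwards [ho.mem_nhds ht] with u hu using hnear u hu
    rw [this.deriv_eq, deriv_const]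
  have hbound : ∀ t, deriv f t ^ 2 + deriv (deriv f) t ^ 2 ≤ B / L := by
    intro t
    have e1 : deriv f t ^ 2 ≤ K₁ ^ 2 / L := by
      rw [(hd1 t).deriv, div_pow]
      have h1 := sq_le_sq' (abs_le.1 (hK₁ ((t - s) / L))).1 (abs_le.1 (hK₁ ((t - s) / L))).2
      gcongr
      nlinarith
    have e2 : deriv (deriv f) t ^ 2 ≤ K₂ ^ 2 / L := by
      rw [(hd2 t).deriv, div_div, div_pow]
      have h1 := sq_le_sq' (abs_le.1 (hK₂ ((t - s) / L))).1 (abs_le.1 (hK₂ ((t - s) / L))).2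
      gcongr
      exact (le_mul_of_one_le_left hL0.le hL1).trans
        (le_self_pow₀ (one_le_mul_of_one_le_of_one_le hL1 hL1) two_ne_zero)
    rw [hB, add_div]
    exact add_le_add e1 e2
  -- The derivatives live on `L ≤ |t - s| ≤ 2L`, two intervals on which the bumps centred at `s ±
  -- 3L/2` equal `1`.
  have hpt : ∀ t, deriv f t ^ 2 + deriv (deriv f) t ^ 2 ≤ B / L *
      (χ ((t - (s - 3 / 2 * L)) / (L / 2)) + χ ((t - (s + 3 / 2 * L)) / (L / 2))) := by
    intro t
    have hBL : 0 ≤ B / L := by positivity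
    have hone : ∀ c, |t - c| ≤ L / 2 → χ ((t - c) / (L / 2)) = 1 := by
      intro c hc
      apply hχ1
      rwa [abs_div, abs_of_pos (half_pos hL0), div_le_one (half_pos hL0)]
    by_cases h1 : |t - s| < L
    · rw [(hflat t h1).1, (hflat t h1).2]
      have := add_nonneg (hχ0 ((t - (s - 3 / 2 * L)) / (L / 2)))
        (hχ0 ((t - (s + 3 / 2 * L)) / (L / 2)))
      simpa using mul_nonneg hBL this
    by_cases h2 : t ∈ Set.Icc (s - 2 * L) (s + 2 * L)
    · refine (hbound t).trans (le_mul_of_one_le_right hBL ?_)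
      rcases le_total t s with h3 | h3
      · rw [abs_of_nonpos (by linarith)] at h1
        rw [hone (s - 3 / 2 * L) (abs_le.2 ⟨by linarith [h2.1], by linarith⟩)]
        linarith [hχ0 ((t - (s + 3 / 2 * L)) / (L / 2))]
      · rw [abs_of_nonneg (by linarith)] at h1
        rw [hone (s + 3 / 2 * L) (abs_le.2 ⟨by linarith, by linarith [h2.2]⟩)]
        linarith [hχ0 ((t - (s - 3 / 2 * L)) / (L / 2))]
    · rw [hfs.deriv.eq_zero t h2, hfs.deriv.deriv.eq_zero t h2]
      have := add_nonneg (hχ0 ((t - (s - 3 / 2 * L)) / (L / 2)))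
        (hχ0 ((t - (s + 3 / 2 * L)) / (L / 2)))
      simpa using mul_nonneg hBL this
  have hsq : ∀ {g : ℝ → ℝ} {a b : ℝ}, SmoothSupportedOn g a b → Integrable (fun t => g t ^ 2) ν := by
    intro g a b hg
    simpa only [sq] using (hg.smul hg.contDiff).integrable ν
  have hmid : ∫ t, χ ((t - s) / (L / 2)) ∂ν ≤ ∫ t, f t ^ 2 ∂ν := by
    refine integral_mono ((hθ.shift s).integrable ν) (hsq hfs) fun t => ?_
    change χ ((t - s) / (L / 2)) ≤ f t ^ 2
    by_cases h1 : |t - s| ≤ L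
    · rw [show f t = 1 from hχ1 _ (by rwa [abs_div, abs_of_pos hL0, div_le_one hL0])]
      simpa using hχle _
    · rw [(hθ.shift s).eq_zero t fun h => h1 (abs_le.2 ⟨by linarith [h.1], by linarith [h.2]⟩)]
      positivity
  have hside : ∀ c, |c - s| = 3 / 2 * L →
      ∫ t, χ ((t - c) / (L / 2)) ∂ν ≤ 3 * ∫ t, f t ^ 2 ∂ν := by
    intro c hc
    have h1 := hν.integral_shift_le hη0 hθ (fun t => hχ0 _) (c₁ := c) (c₂ := s)
      (by linarith [(abs_le.1 hc.le).2]) (by linarith)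
    refine h1.trans ?_
    have h2 : Real.exp (η * (|c - s| + 2 * L)) ≤ 3 := by
      refine (Real.exp_le_exp.2 (?_ : _ ≤ (1 : ℝ))).trans (Real.exp_one_lt_d9.le.trans (by norm_num))
      rw [hc]
      nlinarith [mul_nonneg hη0 hL0.le]
    exact mul_le_mul h2 hmid (integral_nonneg fun t => hχ0 _) (by norm_num)
  refine ⟨f, s - 2 * L, hfs.mono le_rfl (by linarith), ⟨s, by simp [hf, hχ1]⟩, ?_⟩
  have hX : 0 ≤ ∫ t, f t ^ 2 ∂ν := integral_nonneg fun t => sq_nonneg _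
  calc ∫ t, (deriv f t ^ 2 + deriv (deriv f) t ^ 2) ∂ν
      ≤ ∫ t, B / L * (χ ((t - (s - 3 / 2 * L)) / (L / 2)) +
          χ ((t - (s + 3 / 2 * L)) / (L / 2))) ∂ν :=
        integral_mono ((hsq hfs.deriv).add (hsq hfs.deriv.deriv))
          ((((hθ.shift _).integrable ν).add ((hθ.shift _).integrable ν)).const_mul _) hpt
    _ = B / L * (∫ t, χ ((t - (s - 3 / 2 * L)) / (L / 2)) ∂ν +
          ∫ t, χ ((t - (s + 3 / 2 * L)) / (L / 2)) ∂ν) := by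
        rw [integral_const_mul, integral_add ((hθ.shift _).integrable ν)
          ((hθ.shift _).integrable ν)]
    _ ≤ B / L * (3 * ∫ t, f t ^ 2 ∂ν + 3 * ∫ t, f t ^ 2 ∂ν) := by
        have e : |(3 / 2 * L)| = 3 / 2 * L := abs_of_nonneg (by positivity)
        gcongr
        · exact hside _ (by rw [sub_sub_cancel_left, abs_neg, e])
        · exact hside _ (by rw [add_sub_cancel_left, e])
    _ = 6 * B / L * ∫ t, f t ^ 2 ∂ν := by ring
    _ ≤ δ * ∫ t, f t ^ 2 ∂ν := by
        gcongr
        rwa [div_le_iff₀ hL0]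

/-! ### The measure in the variable log ‖x‖. -/

section LogMeasure

variable {N : ℕ}

/-- The image of `‖x‖⁻ᴺ μ` under `x ↦ log ‖x‖`. -/
noncomputable def logMeasure (μ : Measure (EuclideanSpace ℝ (Fin N))) : Measure ℝ :=
  (μ.map (fun x => Real.log ‖x‖)).withDensity (fun t => ENNReal.ofReal (Real.exp (-(N : ℝ) * t)))

theorem measurable_log_norm :
    Measurable (fun x : EuclideanSpace ℝ (Fin N) => Real.log ‖x‖) :=
  Real.measurable_log.comp measurable_norm

instance isFiniteMeasureOnCompacts_logMeasure (μ : Measure (EuclideanSpace ℝ (Fin N)))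
    [IsFiniteMeasure μ] : IsFiniteMeasureOnCompacts (logMeasure μ) := by
  have : IsLocallyFiniteMeasure (logMeasure μ) :=
    IsLocallyFiniteMeasure.withDensity_ofReal (by fun_prop)
  infer_instance

theorem integral_logMeasure (μ : Measure (EuclideanSpace ℝ (Fin N))) {F : ℝ → ℝ}
    (hF : Continuous F) : ∫ t, F t ∂(logMeasure μ) =
      ∫ x, Real.exp (-(N : ℝ) * Real.log ‖x‖) * F (Real.log ‖x‖) ∂μ := by
  rw [logMeasure, integral_withDensity_eq_integral_toReal_smul (by fun_prop) (by simp),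
    integral_map measurable_log_norm.aemeasurable (by
      refine Continuous.aestronglyMeasurable ?_
      simp only [ENNReal.toReal_ofReal (Real.exp_pos _).le]
      fun_prop)]
  simp only [ENNReal.toReal_ofReal (Real.exp_pos _).le, smul_eq_mul]

theorem lintegral_logMeasure (μ : Measure (EuclideanSpace ℝ (Fin N))) {F : ℝ → ℝ}
    (hF : Continuous F) : ∫⁻ t, ENNReal.ofReal (F t) ∂(logMeasure μ) =
      ∫⁻ x, ENNReal.ofReal (Real.exp (-(N : ℝ) * Real.log ‖x‖) * F (Real.log ‖x‖)) ∂μ := by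
  rw [logMeasure, lintegral_withDensity_eq_lintegral_mul _ (by fun_prop) (by fun_prop),
    lintegral_map (by fun_prop) measurable_log_norm]
  simp only [Pi.mul_apply, ENNReal.ofReal_mul (Real.exp_pos _).le]

/-- The origin is excluded because `Real.log 0 = 0 > b`. -/
theorem norm_le_exp_of_log_norm_le {b : ℝ} (hb : b < 0) {x : EuclideanSpace ℝ (Fin N)}
    (hx : Real.log ‖x‖ ≤ b) : 0 < ‖x‖ ∧ ‖x‖ ≤ Real.exp b := by
  have h0 : x ≠ 0 := by
    rintro rfl
    simp at hx
    linarith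
  exact ⟨norm_pos_iff.2 h0, (Real.log_le_iff_le_exp (norm_pos_iff.2 h0)).1 hx⟩

end LogMeasure

section Density

variable {N : ℕ} {ρ : EuclideanSpace ℝ (Fin N) → ℝ}
  {ρ' : EuclideanSpace ℝ (Fin N) → EuclideanSpace ℝ (Fin N)}

theorem IsProbDensity.integral_weightMeasure (hρ : IsProbDensity ρ)
    (F : EuclideanSpace ℝ (Fin N) → ℝ) : ∫ x, F x ∂(weightMeasure ρ) = ∫ x, ρ x * F x := by
  rw [weightMeasure, integral_withDensity_eq_integral_toReal_smul₀
    hρ.integrable.aestronglyMeasurable.aemeasurable.ennreal_ofReal (by simp)]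
  refine integral_congr_ae ?_
  filter_upwards [hρ.nonneg] with x hx
  rw [ENNReal.toReal_ofReal hx, smul_eq_mul]

theorem IsProbDensity.isFiniteMeasure (hρ : IsProbDensity ρ) :
    IsFiniteMeasure (weightMeasure ρ) :=
  isFiniteMeasure_withDensity_ofReal hρ.integrable.2

theorem HypothesisH1.ae_pos (h : HypothesisH1 ρ ρ') :
    ∀ᵐ x ∂(volume : Measure (EuclideanSpace ℝ (Fin N))), 0 < ρ x := by
  have h1 : ∀ n : ℕ, ∀ᵐ x ∂(volume : Measure (EuclideanSpace ℝ (Fin N))),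
      x ∈ Metric.closedBall (0 : EuclideanSpace ℝ (Fin N)) n → 0 < ρ x := by
    intro n
    obtain ⟨a, ha, hK⟩ := h.lower_bound _ (isCompact_closedBall 0 n)
    rw [ae_restrict_iff' measurableSet_closedBall] at hK
    filter_upwards [hK] with x hx hxn using ha.trans_le (hx hxn)
  filter_upwards [ae_all_iff.2 h1] with x hx
  obtain ⟨n, hn⟩ := exists_nat_ge ‖x‖
  exact hx n (mem_closedBall_zero_iff.2 hn)

/-- Lets equalities that hold `μ`-a.e., such as those between `L²_μ` classes, be used Lebesgue-a.e.
-/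
theorem HypothesisH1.volume_absolutelyContinuous (h : HypothesisH1 ρ ρ') :
    volume ≪ weightMeasure ρ := by
  refine withDensity_absolutelyContinuous'
    h.hasWeakGradient.locallyIntegrable.aestronglyMeasurable.aemeasurable.ennreal_ofReal ?_
  filter_upwards [h.ae_pos] with x hx
  simpa using hx

/-- If `|∇ρ| ≤ η ρ / |x|` near the origin, then the logarithmic image of `ρ dx` is slowly varying. -/
theorem IsProbDensity.slowlyVarying_logMeasure (hρ : IsProbDensity ρ) (hw : HasWeakGradient ρ ρ')
    {η b : ℝ} (hb : b < 0)
    (hdrift : ∀ᵐ x ∂(volume : Measure (EuclideanSpace ℝ (Fin N))),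
      ‖x‖ ≤ Real.exp b → ‖x‖ * ‖ρ' x‖ ≤ η * ρ x) :
    SlowlyVarying (logMeasure (weightMeasure ρ)) η b := by
  intro ψ a hψ
  have hs : SmoothSupportedOn (fun t => Real.exp (-(N : ℝ) * t) * ψ t) a b := hψ.expMul _
  -- The factor `e^(-Nt)` cancels the term `N w` in the divergence `N w + w'` of `w (log ‖x‖) x`,
  -- leaving `e^(-Nt) ψ'`, whose `μ`-integral is `∫ ψ' dν`. The components of this field are the
  -- test functions for the weak gradient `ρ'`.
  set w : ℝ → ℝ := fun t => Real.exp (-(N : ℝ) * t) * ψ t with hwdef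
  set φ : Fin N → EuclideanSpace ℝ (Fin N) → ℝ := fun i x => x i * w (Real.log ‖x‖) with hφ
  have hφs : ∀ i, ContDiff ℝ ∞ (φ i) := fun i =>
    (EuclideanSpace.proj (𝕜 := ℝ) i : EuclideanSpace ℝ (Fin N) →L[ℝ] ℝ).contDiff.mul
      (hs.contDiff_radial hb)
  have hφc : ∀ i, HasCompactSupport (φ i) := fun i =>
    HasCompactSupport.mul_left (f := fun x : EuclideanSpace ℝ (Fin N) => x i)
      (hs.hasCompactSupport_radial hb)
  have hI1 : ∀ i, Integrable (fun x => fderiv ℝ (φ i) x (EuclideanSpace.single i 1) * ρ x) := by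
    intro i
    exact hw.locallyIntegrable.integrable_smul_left_of_hasCompactSupport (𝕜 := ℝ)
      (g := fun x => fderiv ℝ (φ i) x (EuclideanSpace.single i 1))
      (((hφs i).continuous_fderiv (by simp)).clm_apply continuous_const)
      ((hφc i).fderiv_apply (𝕜 := ℝ) _)
  have hI2 : ∀ i, Integrable (fun x => φ i x * ρ' x i) := by
    intro i
    have h1 := hw.locallyIntegrable_grad.integrable_smul_left_of_hasCompactSupport
      (hφs i).continuous (hφc i)
    exact (EuclideanSpace.proj (𝕜 := ℝ) i : EuclideanSpace ℝ (Fin N) →L[ℝ] ℝ).integrable_comp h1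
  have hdiv : ∀ x, ∑ i, fderiv ℝ (φ i) x (EuclideanSpace.single i 1) * ρ x =
      ρ x * (Real.exp (-(N : ℝ) * Real.log ‖x‖) * deriv ψ (Real.log ‖x‖)) := by
    intro x
    rw [← Finset.sum_mul, hs.sum_fderiv_coord_mul_radial hb, hψ.deriv_expMul]
    simp only [hwdef]
    ring
  have hgrad : ∀ x, ∑ i, φ i x * ρ' x i = w (Real.log ‖x‖) * inner ℝ x (ρ' x) := by
    intro x
    simp only [hφ, PiLp.inner_apply, Finset.mul_sum, RCLike.inner_apply, conj_trivial]
    exact Finset.sum_congr rfl fun i _ => by ring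
  have hsum : ∫ x, ρ x * (Real.exp (-(N : ℝ) * Real.log ‖x‖) * deriv ψ (Real.log ‖x‖)) =
      -∫ x, w (Real.log ‖x‖) * inner ℝ x (ρ' x) := by
    simp only [← hdiv, ← hgrad]
    rw [integral_finsetSum _ fun i _ => hI1 i, integral_finsetSum _ fun i _ => hI2 i,
      ← Finset.sum_neg_distrib]
    exact Finset.sum_congr rfl fun i _ => hw.integral_eq (φ i) (hφs i) (hφc i) i
  have hIabs : Integrable (fun x => ρ x * |w (Real.log ‖x‖)|) := by
    have h1 := hw.locallyIntegrable.integrable_smul_left_of_hasCompactSupport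
      (g := fun x : EuclideanSpace ℝ (Fin N) => |w (Real.log ‖x‖)|)
      (hs.contDiff_radial hb).continuous.abs (hs.hasCompactSupport_radial hb).norm
    simpa only [smul_eq_mul, mul_comm] using h1
  rw [integral_logMeasure _ hψ.deriv.contDiff.continuous, hρ.integral_weightMeasure, hsum, abs_neg,
    integral_logMeasure _ hψ.contDiff.continuous.abs, hρ.integral_weightMeasure,
    ← integral_const_mul]
  rw [← Real.norm_eq_abs]
  refine (norm_integral_le_integral_norm _).trans ?_
  have habs : ∀ t, Real.exp (-(N : ℝ) * t) * |ψ t| = |w t| := fun t => by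
    rw [hwdef, abs_mul, abs_of_pos (Real.exp_pos _)]
  simp only [habs]
  refine integral_mono_ae ?_ (hIabs.const_mul η) ?_
  · simp only [← hgrad]
    exact (integrable_finsetSum _ fun i _ => hI2 i).norm
  · filter_upwards [hdrift] with x hx
    by_cases h : Real.log ‖x‖ ∈ Set.Icc a b
    · have h1 := hx (norm_le_exp_of_log_norm_le hb h.2).2
      rw [norm_mul, Real.norm_eq_abs, Real.norm_eq_abs]
      calc |w (Real.log ‖x‖)| * |inner ℝ x (ρ' x)|
          ≤ |w (Real.log ‖x‖)| * (η * ρ x) := by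
            gcongr
            exact (abs_real_inner_le_norm _ _).trans h1
        _ = _ := by ring
    · simp [hs.eq_zero _ h]

end Density

theorem enorm_sq_eq_ofReal {F : Type*} [SeminormedAddGroup F] (x : F) :
    ‖x‖ₑ ^ 2 = ENNReal.ofReal (‖x‖ ^ 2) := by
  rw [ENNReal.ofReal_pow (norm_nonneg x), ofReal_norm]

/-- Away from the origin, the preimage of a nonempty open set under `log ‖x‖` is open and nonempty.
This makes `∫ f² dν` strictly positive. -/
theorem isOpenPosMeasure_logMeasure {N : ℕ} (hN : 0 < N)
    {μ : Measure (EuclideanSpace ℝ (Fin N))} (hμ : volume ≪ μ) :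
    (logMeasure μ).IsOpenPosMeasure := by
  refine ⟨fun U hU ⟨t, ht⟩ h0 => ?_⟩
  have h1 : (μ.map fun x => Real.log ‖x‖) U = 0 :=
    withDensity_absolutelyContinuous' (by fun_prop)
      (Filter.Eventually.of_forall fun t => by simp [Real.exp_pos]) h0
  rw [Measure.map_apply measurable_log_norm hU.measurableSet] at h1
  have h2 := hμ h1
  have hopen : IsOpen ({x : EuclideanSpace ℝ (Fin N) | x ≠ 0} ∩ (fun x => Real.log ‖x‖) ⁻¹' U) := by
    refine ContinuousOn.isOpen_inter_preimage ?_ isOpen_ne hU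
    exact ContinuousOn.log continuous_norm.continuousOn fun x hx => norm_ne_zero_iff.2 hx
  refine hopen.measure_ne_zero volume ?_ (measure_mono_null Set.inter_subset_right h2)
  have hn : ‖EuclideanSpace.single (⟨0, hN⟩ : Fin N) (Real.exp t)‖ = Real.exp t := by
    rw [PiLp.norm_single, Real.norm_eq_abs, abs_of_pos (Real.exp_pos t)]
  refine ⟨EuclideanSpace.single ⟨0, hN⟩ (Real.exp t), ?_, ?_⟩
  · exact norm_pos_iff.1 ((Real.exp_pos t).trans_eq hn.symm)
  · simpa only [Set.mem_preimage, hn, Real.log_exp] using ht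

/-! ### Test functions in the domain of the operator. -/

section Operator

variable (𝕜 : Type*) [RCLike 𝕜] {N : ℕ} {ρ : EuclideanSpace ℝ (Fin N) → ℝ}
  {ρ' : EuclideanSpace ℝ (Fin N) → EuclideanSpace ℝ (Fin N)}

variable {𝕜} in
-- A continuous function that vanishes a.e. vanishes everywhere. Single-valuedness is what makes
-- `Submodule.toLinearPMap` have the core graph as its graph.
theorem snd_eq_zero_of_mem_kolmogorovCoreGraph (hac : volume ≪ weightMeasure ρ)
    (p : Lp 𝕜 2 (weightMeasure ρ) × Lp 𝕜 2 (weightMeasure ρ))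
    (hp : p ∈ kolmogorovCoreGraph 𝕜 ρ ρ') (hp1 : p.1 = 0) : p.2 = 0 := by
  obtain ⟨φ, hφ, -, h1, h2⟩ := hp
  rw [hp1] at h1
  have h3 : φ =ᵐ[volume] 0 := hac.ae_le (h1.symm.trans (Lp.coeFn_zero _ _ _))
  have h4 : φ = 0 := (hφ.continuous.ae_eq_iff_eq volume continuous_const).1 h3
  have h5 : kolmogorovExpr ρ ρ' φ = 0 := by
    have h := kolmogorovExpr_smul ρ ρ' (0 : 𝕜) hφ
    rw [zero_smul, zero_smul] at h
    rwa [h4]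
  rw [h5] at h2
  exact Lp.ext (h2.trans (Lp.coeFn_zero _ _ _).symm)

variable {𝕜} in
/-- A test function `φ` for which `φ` and `Lφ` are in `L²` belongs to the domain. -/
theorem exists_mem_domain_of_test_function (hac : volume ≪ weightMeasure ρ)
    {φ : EuclideanSpace ℝ (Fin N) → 𝕜} (hφ : ContDiff ℝ ∞ φ) (hφc : HasCompactSupport φ)
    (h1 : MemLp φ 2 (weightMeasure ρ)) (h2 : MemLp (kolmogorovExpr ρ ρ' φ) 2 (weightMeasure ρ)) :
    ∃ u : (kolmogorovOperator 𝕜 ρ ρ').domain,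
      (u : Lp 𝕜 2 (weightMeasure ρ)) =ᵐ[weightMeasure ρ] φ ∧
      kolmogorovOperator 𝕜 ρ ρ' u =ᵐ[weightMeasure ρ] kolmogorovExpr ρ ρ' φ := by
  have hmem : (h1.toLp, h2.toLp) ∈ kolmogorovCoreGraph 𝕜 ρ ρ' :=
    ⟨φ, hφ, hφc, h1.coeFn_toLp, h2.coeFn_toLp⟩
  rw [← Submodule.toLinearPMap_graph_eq _ (snd_eq_zero_of_mem_kolmogorovCoreGraph hac),
    LinearPMap.mem_graph_iff] at hmem
  obtain ⟨y, hy1, hy2⟩ := hmem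
  -- Only core functions are tested, and the closure extends the core operator whether or not
  -- closability is known.
  have hle := (kolmogorovCoreGraph 𝕜 ρ ρ').toLinearPMap.le_closure
  refine ⟨⟨y, hle.1 y.2⟩, ?_, ?_⟩
  · rw [hy1]
    exact h1.coeFn_toLp
  · have h3 := hle.2 (x := y) (y := ⟨y, hle.1 y.2⟩) rfl
    change ((kolmogorovCoreGraph 𝕜 ρ ρ').toLinearPMap.closure ⟨y, hle.1 y.2⟩ : _ → 𝕜) =ᵐ[_] _
    rw [← h3, hy2]
    exact h2.coeFn_toLp

end Operator

section WeakGradient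

variable {𝕜 : Type*} [RCLike 𝕜] {N : ℕ}

theorem HasWeakGradient.congr {u v : EuclideanSpace ℝ (Fin N) → 𝕜}
    {G : EuclideanSpace ℝ (Fin N) → EuclideanSpace 𝕜 (Fin N)} (h : HasWeakGradient u G)
    (huv : u =ᵐ[volume] v) : HasWeakGradient v G where
  locallyIntegrable := h.locallyIntegrable.congr huv
  locallyIntegrable_grad := h.locallyIntegrable_grad
  integral_eq φ hφ hφc i := by
    rw [← h.integral_eq φ hφ hφc i]
    refine integral_congr_ae ?_
    filter_upwards [huv] with x hx
    rw [hx]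

theorem hasWeakGradient_of_contDiff {u : EuclideanSpace ℝ (Fin N) → 𝕜} (hu : ContDiff ℝ ∞ u) :
    HasWeakGradient u
      (fun x => WithLp.toLp 2 fun i => fderiv ℝ u x (EuclideanSpace.single i 1)) where
  locallyIntegrable := hu.continuous.locallyIntegrable
  locallyIntegrable_grad := by
    refine Continuous.locallyIntegrable ?_
    refine (PiLp.continuous_toLp 2 _).comp (continuous_pi fun i => ?_)
    exact (hu.continuous_fderiv (by simp)).clm_apply continuous_const
  integral_eq φ hφ hφc i := by
    have hc : Continuous fun x => fderiv ℝ u x (EuclideanSpace.single i 1) :=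
      (hu.continuous_fderiv (by simp)).clm_apply continuous_const
    have hc' : Continuous fun x => fderiv ℝ φ x (EuclideanSpace.single i 1) :=
      (hφ.continuous_fderiv (by simp)).clm_apply continuous_const
    have h := integral_bilinear_fderiv_right_eq_neg_left_of_integrable
      (B := ContinuousLinearMap.lsmul ℝ ℝ) (μ := volume) (f := φ) (g := u)
      (v := EuclideanSpace.single i 1)
      ((hc'.smul hu.continuous).integrable_of_hasCompactSupport
        ((hφc.fderiv_apply (𝕜 := ℝ) _).smul_right))
      ((hφ.continuous.smul hc).integrable_of_hasCompactSupport hφc.smul_right)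
      ((hφ.continuous.smul hu.continuous).integrable_of_hasCompactSupport hφc.smul_right)
      (fun x _ => hφ.differentiable (by simp) x) (fun x _ => hu.differentiable (by simp) x)
    simp only [ContinuousLinearMap.lsmul_apply] at h
    simp only [h, neg_neg]

end WeakGradient

/-! ### Radial test functions and the two sides of the inequality. -/

section RadialTest

variable {𝕜 : Type*} [RCLike 𝕜] {N : ℕ} {h : ℝ → ℝ} {a b : ℝ}

/-- The function `x ↦ h (log ‖x‖)` with values in `𝕜`. -/
noncomputable def radialTest (𝕜 : Type*) [RCLike 𝕜] (N : ℕ) (h : ℝ → ℝ)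
    (x : EuclideanSpace ℝ (Fin N)) : 𝕜 :=
  (h (Real.log ‖x‖) : 𝕜)

theorem SmoothSupportedOn.contDiff_radialTest (hh : SmoothSupportedOn h a b) (hb : b < 0) :
    ContDiff ℝ ∞ (radialTest 𝕜 N h) :=
  (RCLike.ofRealCLM (K := 𝕜)).contDiff.comp (hh.contDiff_radial hb)

theorem SmoothSupportedOn.hasCompactSupport_radialTest (hh : SmoothSupportedOn h a b)
    (hb : b < 0) : HasCompactSupport (radialTest 𝕜 N h) :=
  (hh.hasCompactSupport_radial hb).comp_left (g := fun r : ℝ => (r : 𝕜)) (by simp)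

theorem SmoothSupportedOn.fderiv_radialTest (hh : SmoothSupportedOn h a b) (hb : b < 0)
    (x v : EuclideanSpace ℝ (Fin N)) : fderiv ℝ (radialTest 𝕜 N h) x v =
      ((Real.exp (-2 * Real.log ‖x‖) * deriv h (Real.log ‖x‖) * inner ℝ x v : ℝ) : 𝕜) := by
  have h1 : HasFDerivAt (radialTest 𝕜 N h) _ x :=
    (RCLike.ofRealCLM (K := 𝕜)).hasFDerivAt.comp x (hh.hasFDerivAt_radial hb x)
  rw [h1.fderiv]
  simp

theorem SmoothSupportedOn.kolmogorovExpr_radialTest (hh : SmoothSupportedOn h a b) (hb : b < 0)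
    (ρ : EuclideanSpace ℝ (Fin N) → ℝ) (ρ' : EuclideanSpace ℝ (Fin N) → EuclideanSpace ℝ (Fin N))
    (x : EuclideanSpace ℝ (Fin N)) : kolmogorovExpr ρ ρ' (radialTest 𝕜 N h) x =
      ((Real.exp (-2 * Real.log ‖x‖) * (deriv (deriv h) (Real.log ‖x‖) +
        (N - 2) * deriv h (Real.log ‖x‖) +
        deriv h (Real.log ‖x‖) * inner ℝ x ((ρ x)⁻¹ • ρ' x)) : ℝ) : 𝕜) := by
  have h1 : Δ (radialTest 𝕜 N h) x = RCLike.ofRealCLM (K := 𝕜)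
      (Δ (fun x : EuclideanSpace ℝ (Fin N) => h (Real.log ‖x‖)) x) :=
    ContDiffAt.laplacian_CLM_comp_left (l := RCLike.ofRealCLM (K := 𝕜))
      (contDiff_infty.1 (hh.contDiff_radial hb) 2).contDiffAt
  rw [kolmogorovExpr, hh.fderiv_radialTest hb, h1, hh.laplacian_radial hb, RCLike.ofRealCLM_apply,
    ← RCLike.ofReal_add]
  congr 1
  ring

theorem SmoothSupportedOn.norm_sq_grad_radialTest (hh : SmoothSupportedOn h a b) (hb : b < 0)
    (x : EuclideanSpace ℝ (Fin N)) :
    ‖(WithLp.toLp 2 fun i => fderiv ℝ (radialTest 𝕜 N h) x (EuclideanSpace.single i 1) :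
      EuclideanSpace 𝕜 (Fin N))‖ ^ 2 =
      Real.exp (-2 * Real.log ‖x‖) * deriv h (Real.log ‖x‖) ^ 2 := by
  rw [EuclideanSpace.norm_sq_eq]
  simp only [hh.fderiv_radialTest hb, RCLike.norm_ofReal, sq_abs, mul_pow]
  rw [← Finset.mul_sum]
  have h2 : ∑ i : Fin N, inner ℝ x (EuclideanSpace.single i (1 : ℝ)) ^ 2 = ‖x‖ ^ 2 := by
    rw [EuclideanSpace.norm_sq_eq]
    simp [EuclideanSpace.inner_single_right]
  rw [h2]
  rcases eq_or_ne x 0 with rfl | hx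
  · simp [hh.deriv.zero_apply hb]
  · have hn : (0 : ℝ) < ‖x‖ := norm_pos_iff.2 hx
    rw [exp_neg_two_mul_log hn]
    field_simp

end RadialTest

/-- The exponent `-(N - 4) / 2`, critical for Rellich's inequality. -/
noncomputable def rellichExponent (N : ℕ) : ℝ := -(((N : ℝ) - 4) / 2)

/-- The square root `N (N - 4) / 4` of the optimal constant in Rellich's inequality. -/
noncomputable def rellichRoot (N : ℕ) : ℝ := (N : ℝ) * ((N : ℝ) - 4) / 4

theorem integrable_of_continuous_of_zero {ν : Measure ℝ} [IsFiniteMeasureOnCompacts ν] {a b : ℝ}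
    {F : ℝ → ℝ} (hF : Continuous F) (hz : ∀ t, t ∉ Set.Icc a b → F t = 0) : Integrable F ν :=
  hF.integrable_of_hasCompactSupport (HasCompactSupport.intro isCompact_Icc hz)

theorem lintegral_radial_eq {N : ℕ} {μ : Measure (EuclideanSpace ℝ (Fin N))} [IsFiniteMeasure μ]
    {a b : ℝ} {F : ℝ → ℝ} (hF : Continuous F) (hF0 : ∀ t, 0 ≤ F t)
    (hz : ∀ t, t ∉ Set.Icc a b → F t = 0) :
    ∫⁻ x, ENNReal.ofReal (Real.exp (-(N : ℝ) * Real.log ‖x‖) * F (Real.log ‖x‖)) ∂μ =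
      ENNReal.ofReal (∫ t, F t ∂(logMeasure μ)) := by
  rw [← lintegral_logMeasure μ hF, ofReal_integral_eq_lintegral_ofReal
    (integrable_of_continuous_of_zero hF hz) (Filter.Eventually.of_forall hF0)]

section TestFunction

variable {𝕜 : Type*} [RCLike 𝕜] {N : ℕ} {f : ℝ → ℝ} {a b : ℝ}

theorem SmoothSupportedOn.deriv_add_const_mul (hf : SmoothSupportedOn f a b) (k : ℝ) :
    SmoothSupportedOn (fun t => deriv f t + k * f t) a b :=
  hf.deriv.add (hf.smul contDiff_const)

theorem SmoothSupportedOn.deriv_deriv_expMul (hf : SmoothSupportedOn f a b) (k t : ℝ) :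
    deriv (deriv fun t => Real.exp (k * t) * f t) t =
      Real.exp (k * t) * (deriv (deriv f) t + 2 * k * deriv f t + k ^ 2 * f t) := by
  rw [show deriv (fun t => Real.exp (k * t) * f t) =
    fun t => Real.exp (k * t) * (deriv f t + k * f t) from funext (hf.deriv_expMul k),
    (hf.deriv_add_const_mul k).deriv_expMul]
  have : HasDerivAt (fun t => deriv f t + k * f t) (deriv (deriv f) t + k * deriv f t) t :=
    (hf.deriv.hasDerivAt t).add ((hf.hasDerivAt t).const_mul k)
  rw [this.deriv]
  ring

variable (𝕜 N f) in
/-- The test function `|x| ^ (-(N - 4) / 2) f (log |x|)`. -/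
noncomputable def rellichTest : EuclideanSpace ℝ (Fin N) → 𝕜 :=
  radialTest 𝕜 N fun t => Real.exp (rellichExponent N * t) * f t

theorem enorm_sq_rellichTest (x : EuclideanSpace ℝ (Fin N)) :
    ‖rellichTest 𝕜 N f x‖ₑ ^ 2 = ENNReal.ofReal (Real.exp (-(N : ℝ) * Real.log ‖x‖) *
      (Real.exp (4 * Real.log ‖x‖) * f (Real.log ‖x‖) ^ 2)) := by
  rw [enorm_sq_eq_ofReal, rellichTest, radialTest, RCLike.norm_ofReal, sq_abs, mul_pow, ← mul_assoc,
    ← Real.exp_add, ← Real.exp_nat_mul]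
  congr 3
  rw [rellichExponent]
  push_cast
  ring_nf

/-- Since `2α - 4 = -N` for `α = rellichExponent N`, what remains is exactly the density of
`logMeasure`, with no further weight. -/
theorem enorm_sq_rellichTest_div (hf : SmoothSupportedOn f a b) (hb : b < 0)
    (x : EuclideanSpace ℝ (Fin N)) :
    ‖rellichTest 𝕜 N f x‖ₑ ^ 2 / ‖x‖ₑ ^ 4 =
      ENNReal.ofReal (Real.exp (-(N : ℝ) * Real.log ‖x‖) * f (Real.log ‖x‖) ^ 2) := by
  rw [enorm_sq_rellichTest]
  rcases eq_or_ne x 0 with rfl | hx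
  · simp [hf.zero_apply hb]
  · have hn : (0 : ℝ) < ‖x‖ := norm_pos_iff.2 hx
    rw [← ofReal_norm, ← ENNReal.ofReal_pow hn.le, ← ENNReal.ofReal_div_of_pos (pow_pos hn 4)]
    have : Real.exp (4 * Real.log ‖x‖) = ‖x‖ ^ 4 := by
      rw [mul_comm, Real.exp_mul, Real.exp_log hn]
      norm_num
    rw [this]
    congr 1
    field_simp

theorem enorm_sq_grad_rellichTest (hf : SmoothSupportedOn f a b) (hb : b < 0)
    (x : EuclideanSpace ℝ (Fin N)) :
    ‖(WithLp.toLp 2 fun i => fderiv ℝ (rellichTest 𝕜 N f) x (EuclideanSpace.single i 1) :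
      EuclideanSpace 𝕜 (Fin N))‖ₑ ^ 2 =
      ENNReal.ofReal (Real.exp (-(N : ℝ) * Real.log ‖x‖) * (Real.exp (2 * Real.log ‖x‖) *
        (deriv f (Real.log ‖x‖) + rellichExponent N * f (Real.log ‖x‖)) ^ 2)) := by
  rw [enorm_sq_eq_ofReal, rellichTest, (hf.expMul (rellichExponent N)).norm_sq_grad_radialTest hb,
    hf.deriv_expMul, mul_pow, ← mul_assoc, ← mul_assoc, ← Real.exp_nat_mul, ← Real.exp_add,
    ← Real.exp_add]
  congr 3
  rw [rellichExponent]
  push_cast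
  ring_nf

/-- Conjugating `∂² + (N - 2) ∂` by `e^(αt)` gives `∂² + (2α + N - 2) ∂ + α (α + N - 2)`, and for
the critical `α` the coefficients are `2` and `-rellichRoot N`. Cauchy-Schwarz bounds the drift
term. -/
theorem norm_kolmogorovExpr_rellichTest_le (hf : SmoothSupportedOn f a b) (hb : b < 0)
    {ρ : EuclideanSpace ℝ (Fin N) → ℝ} {ρ' : EuclideanSpace ℝ (Fin N) → EuclideanSpace ℝ (Fin N)}
    {η : ℝ} {x : EuclideanSpace ℝ (Fin N)}
    (hx : ‖x‖ ≤ Real.exp b → ‖x‖ * ‖(ρ x)⁻¹ • ρ' x‖ ≤ η) :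
    ‖kolmogorovExpr ρ ρ' (rellichTest 𝕜 N f) x‖ ≤
      Real.exp ((rellichExponent N - 2) * Real.log ‖x‖) *
        (|deriv (deriv f) (Real.log ‖x‖) + 2 * deriv f (Real.log ‖x‖) -
            rellichRoot N * f (Real.log ‖x‖)| +
          η * |deriv f (Real.log ‖x‖) + rellichExponent N * f (Real.log ‖x‖)|) := by
  rw [rellichTest, (hf.expMul (rellichExponent N)).kolmogorovExpr_radialTest hb,
    hf.deriv_deriv_expMul, hf.deriv_expMul, RCLike.norm_ofReal]
  set t := Real.log ‖x‖ with ht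
  have e : Real.exp (-2 * t) * (Real.exp (rellichExponent N * t) *
      (deriv (deriv f) t + 2 * rellichExponent N * deriv f t + rellichExponent N ^ 2 * f t) +
      (N - 2) * (Real.exp (rellichExponent N * t) * (deriv f t + rellichExponent N * f t)) +
      Real.exp (rellichExponent N * t) * (deriv f t + rellichExponent N * f t) *
        inner ℝ x ((ρ x)⁻¹ • ρ' x)) =
      Real.exp ((rellichExponent N - 2) * t) * ((deriv (deriv f) t + 2 * deriv f t -
        rellichRoot N * f t) + inner ℝ x ((ρ x)⁻¹ • ρ' x) *
          (deriv f t + rellichExponent N * f t)) := by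
    rw [show (rellichExponent N - 2) * t = -2 * t + rellichExponent N * t by ring, Real.exp_add,
      rellichExponent, rellichRoot]
    ring
  rw [e, abs_mul, abs_of_pos (Real.exp_pos _)]
  gcongr
  refine (abs_add_le _ _).trans ?_
  gcongr
  by_cases h : t ∈ Set.Icc a b
  · rw [abs_mul]
    gcongr
    exact (abs_real_inner_le_norm _ _).trans (hx (norm_le_exp_of_log_norm_le hb h.2).2)
  · simp [hf.eq_zero t h, hf.deriv.eq_zero t h]

end TestFunction

section Inequality

variable {𝕜 : Type*} [RCLike 𝕜] {N : ℕ} {ρ : EuclideanSpace ℝ (Fin N) → ℝ}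
  {ρ' : EuclideanSpace ℝ (Fin N) → EuclideanSpace ℝ (Fin N)} {f : ℝ → ℝ} {a b η : ℝ}

/-- The pointwise bound is a continuous compactly supported function of `log ‖x‖`, so `Lu` is
bounded and `μ` is finite; square integrability of the drift against `μ` is not needed. -/
theorem memLp_kolmogorovExpr_rellichTest (hρ : IsProbDensity ρ) (hw : HasWeakGradient ρ ρ')
    (hf : SmoothSupportedOn f a b) (hb : b < 0)
    (hdrift : ∀ᵐ x ∂(weightMeasure ρ), ‖x‖ ≤ Real.exp b → ‖x‖ * ‖(ρ x)⁻¹ • ρ' x‖ ≤ η) :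
    MemLp (kolmogorovExpr ρ ρ' (rellichTest 𝕜 N f)) 2 (weightMeasure ρ) := by
  have := hρ.isFiniteMeasure
  have hg := hf.expMul (rellichExponent N)
  set F : ℝ → ℝ := fun t => Real.exp ((rellichExponent N - 2) * t) *
    (|deriv (deriv f) t + 2 * deriv f t - rellichRoot N * f t| +
      η * |deriv f t + rellichExponent N * f t|) with hF
  have c0 := hf.contDiff.continuous
  have c1 := hf.deriv.contDiff.continuous
  have c2 := hf.deriv.deriv.contDiff.continuous
  have hFc : Continuous F := by fun_prop
  have hF0 : HasCompactSupport F := HasCompactSupport.intro (isCompact_Icc (a := a) (b := b))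
    fun t ht => by simp [hF, hf.eq_zero t ht, hf.deriv.eq_zero t ht, hf.deriv.deriv.eq_zero t ht]
  obtain ⟨K, hK⟩ := hF0.exists_abs_le hFc
  refine MemLp.of_bound ?_ K ?_
  · have hfun : kolmogorovExpr ρ ρ' (rellichTest 𝕜 N f) = fun x => _ :=
      funext (hg.kolmogorovExpr_radialTest hb ρ ρ')
    rw [hfun]
    refine AEStronglyMeasurable.mono_ac (withDensity_absolutelyContinuous _ _) ?_
    have m1 := hg.deriv.contDiff.continuous.measurable.comp (measurable_log_norm (N := N))
    have m2 := hg.deriv.deriv.contDiff.continuous.measurable.comp (measurable_log_norm (N := N))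
    have m3 : AEStronglyMeasurable (fun x => inner ℝ x ((ρ x)⁻¹ • ρ' x)) volume :=
      AEStronglyMeasurable.inner aestronglyMeasurable_id
        (hw.locallyIntegrable.aestronglyMeasurable.aemeasurable.inv.aestronglyMeasurable.smul
          hw.locallyIntegrable_grad.aestronglyMeasurable)
    have m4 : Measurable fun x : EuclideanSpace ℝ (Fin N) => Real.exp (-2 * Real.log ‖x‖) :=
      Real.measurable_exp.comp (measurable_log_norm.const_mul _)
    refine RCLike.continuous_ofReal.comp_aestronglyMeasurable ?_
    exact m4.aestronglyMeasurable.mul (((m2.add (m1.const_mul _)).aestronglyMeasurable).add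
      (m1.aestronglyMeasurable.mul m3))
  · filter_upwards [hdrift] with x hx
    exact (norm_kolmogorovExpr_rellichTest_le hf hb hx).trans ((le_abs_self _).trans (hK _))

/-- The weighted Rellich inequality, applied to a test function depending on `log |x|` only. -/
theorem rellich_inequality_logMeasure (hρ : IsProbDensity ρ) (hH1 : HypothesisH1 ρ ρ')
    (hf : SmoothSupportedOn f a b) (hb : b < 0)
    (hdrift : ∀ᵐ x ∂(weightMeasure ρ), ‖x‖ ≤ Real.exp b → ‖x‖ * ‖(ρ x)⁻¹ • ρ' x‖ ≤ η)
    {c C : ℝ} (hc : 0 ≤ c) (hC : 0 ≤ C)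
    (hR : ∀ u : (kolmogorovOperator 𝕜 ρ ρ').domain,
      ENNReal.ofReal c *
          ∫⁻ x, ‖(u : Lp 𝕜 2 (weightMeasure ρ)) x‖ₑ ^ 2 / ‖x‖ₑ ^ 4 ∂(weightMeasure ρ) ≤
        (∫⁻ x, ‖(kolmogorovOperator 𝕜 ρ ρ' u) x‖ₑ ^ 2 ∂(weightMeasure ρ)) +
          ENNReal.ofReal C * weightedH1NormSq ρ (u : Lp 𝕜 2 (weightMeasure ρ))) :
    c * ∫ t, f t ^ 2 ∂(logMeasure (weightMeasure ρ)) ≤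
      ∫ t, (|deriv (deriv f) t + 2 * deriv f t - rellichRoot N * f t| +
          η * |deriv f t + rellichExponent N * f t|) ^ 2 ∂(logMeasure (weightMeasure ρ)) +
        C * (∫ t, Real.exp (4 * t) * f t ^ 2 ∂(logMeasure (weightMeasure ρ)) +
          ∫ t, Real.exp (2 * t) * (deriv f t + rellichExponent N * f t) ^ 2
            ∂(logMeasure (weightMeasure ρ))) := by
  have := hρ.isFiniteMeasure
  have hac := hH1.volume_absolutelyContinuous
  have hg := hf.expMul (rellichExponent N)
  have c0 := hf.contDiff.continuous
  have c1 := hf.deriv.contDiff.continuous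
  have c2 := hf.deriv.deriv.contDiff.continuous
  have hcd : ContDiff ℝ ∞ (rellichTest 𝕜 N f) := hg.contDiff_radialTest hb
  have hcs : HasCompactSupport (rellichTest 𝕜 N f) := hg.hasCompactSupport_radialTest hb
  obtain ⟨u, hu, hLu⟩ := exists_mem_domain_of_test_function hac hcd hcs
    (hcd.continuous.memLp_of_hasCompactSupport hcs)
    (memLp_kolmogorovExpr_rellichTest hρ hH1.hasWeakGradient hf hb hdrift)
  have hineq := hR u
  have e1 : ∫⁻ x, ‖(u : Lp 𝕜 2 (weightMeasure ρ)) x‖ₑ ^ 2 / ‖x‖ₑ ^ 4 ∂(weightMeasure ρ) =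
      ENNReal.ofReal (∫ t, f t ^ 2 ∂(logMeasure (weightMeasure ρ))) := by
    rw [← lintegral_radial_eq (a := a) (b := b) (by fun_prop) (fun t => sq_nonneg _)
      (fun t ht => by simp [hf.eq_zero t ht])]
    refine lintegral_congr_ae ?_
    filter_upwards [hu] with x hx
    rw [hx, enorm_sq_rellichTest_div hf hb]
  have e2 : ∫⁻ x, ‖(kolmogorovOperator 𝕜 ρ ρ' u) x‖ₑ ^ 2 ∂(weightMeasure ρ) ≤
      ENNReal.ofReal (∫ t, (|deriv (deriv f) t + 2 * deriv f t - rellichRoot N * f t| +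
          η * |deriv f t + rellichExponent N * f t|) ^ 2 ∂(logMeasure (weightMeasure ρ))) := by
    rw [← lintegral_radial_eq (a := a) (b := b) (by fun_prop) (fun t => sq_nonneg _)
      (fun t ht => by
        simp [hf.eq_zero t ht, hf.deriv.eq_zero t ht, hf.deriv.deriv.eq_zero t ht])]
    refine lintegral_mono_ae ?_
    filter_upwards [hLu, hdrift] with x hx hdx
    rw [hx, enorm_sq_eq_ofReal]
    refine ENNReal.ofReal_le_ofReal ?_
    refine (pow_le_pow_left₀ (norm_nonneg _)
      (norm_kolmogorovExpr_rellichTest_le hf hb hdx) 2).trans_eq ?_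
    rw [mul_pow, ← Real.exp_nat_mul]
    congr 2
    rw [rellichExponent]
    push_cast
    ring
  have e3 : weightedH1NormSq ρ (u : Lp 𝕜 2 (weightMeasure ρ)) ≤
      ENNReal.ofReal (∫ t, Real.exp (4 * t) * f t ^ 2 ∂(logMeasure (weightMeasure ρ))) +
      ENNReal.ofReal (∫ t, Real.exp (2 * t) * (deriv f t + rellichExponent N * f t) ^ 2
        ∂(logMeasure (weightMeasure ρ))) := by
    refine add_le_add (le_of_eq ?_) ?_
    · rw [← lintegral_radial_eq (a := a) (b := b) (by fun_prop) (fun t => by positivity)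
        (fun t ht => by simp [hf.eq_zero t ht])]
      refine lintegral_congr_ae ?_
      filter_upwards [hu] with x hx
      rw [hx, enorm_sq_rellichTest]
    · rw [← lintegral_radial_eq (a := a) (b := b) (by fun_prop) (fun t => by positivity)
        (fun t ht => by simp [hf.eq_zero t ht, hf.deriv.eq_zero t ht])]
      -- The classical gradient is one competitor in the infimum, which suffices for an upper bound.
      refine (iInf₂_le _ ((hasWeakGradient_of_contDiff hcd).congr (hac.ae_eq hu.symm))).trans
        (le_of_eq ?_)
      exact lintegral_congr fun x => enorm_sq_grad_rellichTest hf hb x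
  have h2 := hineq.trans (add_le_add e2 (mul_le_mul_right e3 _))
  have p1 : 0 ≤ ∫ t, (|deriv (deriv f) t + 2 * deriv f t - rellichRoot N * f t| +
      η * |deriv f t + rellichExponent N * f t|) ^ 2 ∂(logMeasure (weightMeasure ρ)) :=
    integral_nonneg fun t => sq_nonneg _
  have p2 : 0 ≤ ∫ t, Real.exp (4 * t) * f t ^ 2 ∂(logMeasure (weightMeasure ρ)) :=
    integral_nonneg fun t => by positivity
  have p3 : 0 ≤ ∫ t, Real.exp (2 * t) * (deriv f t + rellichExponent N * f t) ^ 2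
      ∂(logMeasure (weightMeasure ρ)) := integral_nonneg fun t => by positivity
  rw [e1, ← ENNReal.ofReal_mul hc, ← ENNReal.ofReal_add p2 p3, ← ENNReal.ofReal_mul hC,
    ← ENNReal.ofReal_add p1 (mul_nonneg hC (add_nonneg p2 p3))] at h2
  exact (ENNReal.ofReal_le_ofReal_iff (add_nonneg p1 (mul_nonneg hC (add_nonneg p2 p3)))).1 h2

end Inequality

/-! ### Choice of parameters and contradiction. -/

/-- The left-hand side tends to `A²` as `δ → 0`: the singular `1/δ` is paired with `δ²`. This is why
the test function is taken with derivative ratio `δ²` and not `δ`. -/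
theorem exists_small_perturbation_lt {A n C c : ℝ} (h : A ^ 2 < c) :
    ∃ δ : ℝ, 0 < δ ∧ δ ≤ 1 ∧ (1 + δ) * (A + n * δ) ^ 2 + C * δ * (1 + 2 * n ^ 2) +
      (10 * (1 + 1 / δ) + 2 * C * δ) * δ ^ 2 < c := by
  have hc : Continuous fun δ : ℝ => (1 + δ) * (A + n * δ) ^ 2 + C * δ * (1 + 2 * n ^ 2) +
      (10 * (δ ^ 2 + δ) + 2 * C * δ ^ 3) := by fun_prop
  have h0 := (hc.tendsto 0).eventually_lt_const (u := c) (by simpa using h)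
  obtain ⟨r, hr, hball⟩ := Metric.eventually_nhds_iff.1 h0
  refine ⟨min 1 (r / 2), by positivity, min_le_left _ _, ?_⟩
  have hpos : 0 < min 1 (r / 2) := by positivity
  have hlt : dist (min 1 (r / 2)) 0 < r := by
    rw [Real.dist_eq, sub_zero, abs_of_pos hpos]
    linarith [min_le_right 1 (r / 2)]
  have h1 := hball hlt
  set δ := min 1 (r / 2)
  have e : (10 * (1 + 1 / δ) + 2 * C * δ) * δ ^ 2 = 10 * (δ ^ 2 + δ) + 2 * C * δ ^ 3 := by
    field_simp
  rwa [e]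

/-- Young's inequality with weight `δ` separates the main part `(A + nδ)|p|` from the derivative
part `|s| + 3|q|`; the constant is `10 = 1² + 3²`. -/
theorem abs_add_mul_abs_sq_le {A α n δ η p q s : ℝ} (hA : 0 ≤ A) (hα : |α| ≤ n) (hδ : 0 < δ)
    (hδ1 : δ ≤ 1) (hη : 0 ≤ η) (hηδ : η ≤ δ) :
    (|s + 2 * q - A * p| + η * |q + α * p|) ^ 2 ≤
      (1 + δ) * (A + n * δ) ^ 2 * p ^ 2 + 10 * (1 + 1 / δ) * (q ^ 2 + s ^ 2) := by
  have h1 : |s + 2 * q - A * p| ≤ |s| + 2 * |q| + A * |p| := by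
    refine (abs_sub _ _).trans ((add_le_add_left (abs_add_le _ _) _).trans_eq ?_)
    rw [abs_mul, abs_mul, abs_of_nonneg hA, abs_two]
  have h2 : η * |q + α * p| ≤ |q| + n * δ * |p| := by
    have hn : 0 ≤ n := (abs_nonneg α).trans hα
    calc η * |q + α * p| ≤ η * (|q| + |α| * |p|) := by
          gcongr
          exact (abs_add_le _ _).trans_eq (by rw [abs_mul])
      _ = η * |q| + η * (|α| * |p|) := by ring
      _ ≤ 1 * |q| + δ * (n * |p|) := by
          gcongr
          exact hηδ.trans hδ1
      _ = _ := by ring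
  set u := (A + n * δ) * |p| with hu
  set v := |s| + 3 * |q| with hv
  have h3 : |s + 2 * q - A * p| + η * |q + α * p| ≤ u + v := by
    rw [hu, hv]
    linarith
  have h4 : (u + v) ^ 2 ≤ (1 + δ) * u ^ 2 + (1 + 1 / δ) * v ^ 2 := by
    have e : (1 + δ) * u ^ 2 + (1 + 1 / δ) * v ^ 2 - (u + v) ^ 2 = (δ * u - v) ^ 2 / δ := by
      field_simp
      ring
    have : 0 ≤ (δ * u - v) ^ 2 / δ := by positivity
    linarith
  have h5 : v ^ 2 ≤ 10 * (q ^ 2 + s ^ 2) := by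
    rw [← sq_abs q, ← sq_abs s]
    nlinarith [sq_nonneg (3 * |s| - |q|)]
  have h6 : u ^ 2 = (A + n * δ) ^ 2 * p ^ 2 := by rw [hu, mul_pow, sq_abs]
  calc (|s + 2 * q - A * p| + η * |q + α * p|) ^ 2 ≤ (u + v) ^ 2 :=
        pow_le_pow_left₀ (by positivity) h3 2
    _ ≤ (1 + δ) * u ^ 2 + (1 + 1 / δ) * v ^ 2 := h4
    _ ≤ (1 + δ) * u ^ 2 + (1 + 1 / δ) * (10 * (q ^ 2 + s ^ 2)) := by gcongr
    _ = _ := by rw [h6]; ring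

/-- Upper bound for the right-hand side of the Rellich inequality for a test function with small
derivatives. -/
theorem integral_rellich_le {ν : Measure ℝ} [IsFiniteMeasureOnCompacts ν] {f : ℝ → ℝ} {a b : ℝ}
    (hf : SmoothSupportedOn f a b) {A α n δ η C : ℝ} (hA : 0 ≤ A) (hα : |α| ≤ n) (hδ : 0 < δ)
    (hδ1 : δ ≤ 1) (hη : 0 ≤ η) (hηδ : η ≤ δ) (hC : 0 ≤ C) (hb : b < 0)
    (hbδ : Real.exp b ≤ δ)
    (hsmall : ∫ t, (deriv f t ^ 2 + deriv (deriv f) t ^ 2) ∂ν ≤ δ ^ 2 * ∫ t, f t ^ 2 ∂ν) :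
    ∫ t, (|deriv (deriv f) t + 2 * deriv f t - A * f t| + η * |deriv f t + α * f t|) ^ 2 ∂ν +
        C * (∫ t, Real.exp (4 * t) * f t ^ 2 ∂ν +
          ∫ t, Real.exp (2 * t) * (deriv f t + α * f t) ^ 2 ∂ν) ≤
      ((1 + δ) * (A + n * δ) ^ 2 + C * δ * (1 + 2 * n ^ 2) +
        (10 * (1 + 1 / δ) + 2 * C * δ) * δ ^ 2) * ∫ t, f t ^ 2 ∂ν := by
  have c0 := hf.contDiff.continuous
  have c1 := hf.deriv.contDiff.continuous
  have c2 := hf.deriv.deriv.contDiff.continuous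
  have i0 : Integrable (fun t => f t ^ 2) ν :=
    integrable_of_continuous_of_zero (a := a) (b := b) (by fun_prop)
      fun t ht => by simp [hf.eq_zero t ht]
  have i1 : Integrable (fun t => deriv f t ^ 2 + deriv (deriv f) t ^ 2) ν :=
    integrable_of_continuous_of_zero (a := a) (b := b) (by fun_prop)
      fun t ht => by simp [hf.deriv.eq_zero t ht, hf.deriv.deriv.eq_zero t ht]
  have i2 : Integrable (fun t => (|deriv (deriv f) t + 2 * deriv f t - A * f t| +
      η * |deriv f t + α * f t|) ^ 2) ν :=
    integrable_of_continuous_of_zero (a := a) (b := b) (by fun_prop) fun t ht => by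
      simp [hf.eq_zero t ht, hf.deriv.eq_zero t ht, hf.deriv.deriv.eq_zero t ht]
  have i3 : Integrable (fun t => Real.exp (4 * t) * f t ^ 2) ν :=
    integrable_of_continuous_of_zero (a := a) (b := b) (by fun_prop)
      fun t ht => by simp [hf.eq_zero t ht]
  have i4 : Integrable (fun t => Real.exp (2 * t) * (deriv f t + α * f t) ^ 2) ν :=
    integrable_of_continuous_of_zero (a := a) (b := b) (by fun_prop)
      fun t ht => by simp [hf.eq_zero t ht, hf.deriv.eq_zero t ht]
  have i5 : Integrable (fun t => Real.exp (4 * t) * f t ^ 2 +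
      Real.exp (2 * t) * (deriv f t + α * f t) ^ 2) ν := i3.add i4
  -- The extra weights of the `H¹` terms are small because `f` is supported where `t ≤ b < 0`.
  have hexp : ∀ k : ℝ, 1 ≤ k → ∀ t ≤ b, Real.exp (k * t) ≤ δ := fun k hk t ht =>
    (Real.exp_le_exp.2 (by nlinarith)).trans hbδ
  have hpt : ∀ t, (|deriv (deriv f) t + 2 * deriv f t - A * f t| +
      η * |deriv f t + α * f t|) ^ 2 + C * (Real.exp (4 * t) * f t ^ 2 +
        Real.exp (2 * t) * (deriv f t + α * f t) ^ 2) ≤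
      ((1 + δ) * (A + n * δ) ^ 2 + C * δ * (1 + 2 * n ^ 2)) * f t ^ 2 +
        (10 * (1 + 1 / δ) + 2 * C * δ) * (deriv f t ^ 2 + deriv (deriv f) t ^ 2) := by
    intro t
    by_cases ht : t ∈ Set.Icc a b
    · have h1 := abs_add_mul_abs_sq_le (p := f t) (q := deriv f t) (s := deriv (deriv f) t)
        hA hα hδ hδ1 hη hηδ
      have h2 : (deriv f t + α * f t) ^ 2 ≤ 2 * deriv f t ^ 2 + 2 * n ^ 2 * f t ^ 2 := by
        have h3 : α ^ 2 ≤ n ^ 2 := sq_le_sq' (abs_le.1 hα).1 (abs_le.1 hα).2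
        nlinarith [sq_nonneg (deriv f t - α * f t), mul_le_mul_of_nonneg_right h3 (sq_nonneg (f t))]
      have h4 : Real.exp (4 * t) * f t ^ 2 + Real.exp (2 * t) * (deriv f t + α * f t) ^ 2 ≤
          δ * f t ^ 2 + δ * (2 * deriv f t ^ 2 + 2 * n ^ 2 * f t ^ 2) := by
        gcongr
        · exact hexp 4 (by norm_num) t ht.2
        · exact hexp 2 (by norm_num) t ht.2
      have h5 := mul_le_mul_of_nonneg_left h4 hC
      have h6 : 0 ≤ C * δ * deriv (deriv f) t ^ 2 := by positivity
      linarith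
    · simp [hf.eq_zero t ht, hf.deriv.eq_zero t ht, hf.deriv.deriv.eq_zero t ht]
  have hM : 0 ≤ 10 * (1 + 1 / δ) + 2 * C * δ := by positivity
  calc _ = ∫ t, ((|deriv (deriv f) t + 2 * deriv f t - A * f t| +
      η * |deriv f t + α * f t|) ^ 2 + C * (Real.exp (4 * t) * f t ^ 2 +
        Real.exp (2 * t) * (deriv f t + α * f t) ^ 2)) ∂ν := by
        rw [integral_add i2 (i5.const_mul C), integral_const_mul, integral_add i3 i4]
    _ ≤ ∫ t, (((1 + δ) * (A + n * δ) ^ 2 + C * δ * (1 + 2 * n ^ 2)) * f t ^ 2 +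
        (10 * (1 + 1 / δ) + 2 * C * δ) * (deriv f t ^ 2 + deriv (deriv f) t ^ 2)) ∂ν :=
        integral_mono (i2.add (i5.const_mul C))
          ((i0.const_mul _).add (i1.const_mul _)) hpt
    _ = ((1 + δ) * (A + n * δ) ^ 2 + C * δ * (1 + 2 * n ^ 2)) * ∫ t, f t ^ 2 ∂ν +
        (10 * (1 + 1 / δ) + 2 * C * δ) * ∫ t, (deriv f t ^ 2 + deriv (deriv f) t ^ 2) ∂ν := by
        rw [integral_add (i0.const_mul _) (i1.const_mul _), integral_const_mul, integral_const_mul]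
    _ ≤ ((1 + δ) * (A + n * δ) ^ 2 + C * δ * (1 + 2 * n ^ 2)) * ∫ t, f t ^ 2 ∂ν +
        (10 * (1 + 1 / δ) + 2 * C * δ) * (δ ^ 2 * ∫ t, f t ^ 2 ∂ν) := by gcongr
    _ = _ := by ring

/-- Near the origin, the drift is bounded by an arbitrarily small multiple of `1 / |x|`. -/
theorem exists_norm_mul_norm_le_of_drift {E F : Type*} [NormedAddCommGroup E] [MeasurableSpace E]
    [BorelSpace E] [NormedAddCommGroup F] {μ : Measure E} {B : E → F} {R₁ : ℝ} (hR₁ : 0 < R₁)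
    (hdrift : ∀ ε : ℝ, 0 < ε → ∃ Cε : ℝ, 0 < Cε ∧ ∀ᵐ x ∂(μ.restrict (Metric.ball (0 : E) R₁)),
      ‖B x‖ ^ 2 ≤ ε / ‖x‖ ^ 2 + Cε) {η δ : ℝ} (hη : 0 < η) (hδ : 0 < δ) :
    ∃ b : ℝ, b < 0 ∧ Real.exp b ≤ δ ∧ ∀ᵐ x ∂μ, ‖x‖ ≤ Real.exp b → ‖x‖ * ‖B x‖ ≤ η := by
  -- Half of `η²` pays for the singular term; the other half pays for `K ‖x‖²` on a small ball.
  obtain ⟨K, hK, hae⟩ := hdrift (η ^ 2 / 2) (by positivity)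
  obtain ⟨r, hr, hr1, hrδ, hrR, hrK⟩ :
      ∃ r : ℝ, 0 < r ∧ r < 1 ∧ r ≤ δ ∧ r < R₁ ∧ K * r ≤ η ^ 2 / 2 := by
    refine ⟨min (min (1 / 2) δ) (min (R₁ / 2) (η ^ 2 / 2 / K)), by positivity, ?_, ?_, ?_, ?_⟩
    · linarith [min_le_left (min (1 / 2) δ) (min (R₁ / 2) (η ^ 2 / 2 / K)),
        min_le_left (1 / 2) δ]
    · exact (min_le_left _ _).trans (min_le_right _ _)
    · linarith [min_le_right (min (1 / 2) δ) (min (R₁ / 2) (η ^ 2 / 2 / K)),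
        min_le_left (R₁ / 2) (η ^ 2 / 2 / K)]
    · rw [← le_div_iff₀' hK]
      exact (min_le_right _ _).trans (min_le_right _ _)
  refine ⟨Real.log r, Real.log_neg hr hr1, by rwa [Real.exp_log hr], ?_⟩
  rw [ae_restrict_iff' Metric.isOpen_ball.measurableSet] at hae
  filter_upwards [hae] with x hx hxr
  rw [Real.exp_log hr] at hxr
  rcases eq_or_ne x 0 with rfl | h0
  · simpa using hη.le
  have hn : 0 < ‖x‖ := norm_pos_iff.2 h0
  have h1 := hx (mem_ball_zero_iff.2 (hxr.trans_lt hrR))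
  refine abs_le_of_sq_le_sq' ?_ hη.le |>.2
  calc (‖x‖ * ‖B x‖) ^ 2 = ‖x‖ ^ 2 * ‖B x‖ ^ 2 := mul_pow _ _ _
    _ ≤ ‖x‖ ^ 2 * (η ^ 2 / 2 / ‖x‖ ^ 2 + K) := by gcongr
    _ = η ^ 2 / 2 + K * (‖x‖ * ‖x‖) := by
        field_simp
    _ ≤ η ^ 2 / 2 + K * (r * 1) := by
        gcongr
        exact hxr.trans hr1.le
    _ ≤ η ^ 2 := by linarith

theorem hardyConst_sub_one_eq (N : ℕ) : hardyConst N - 1 = rellichRoot N := by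
  rw [hardyConst, rellichRoot]
  ring

theorem mainTheorem2 {𝕜 : Type*} [RCLike 𝕜] (N : ℕ) (hN : 5 ≤ N)
    (ρ : EuclideanSpace ℝ (Fin N) → ℝ)
    (ρ' : EuclideanSpace ℝ (Fin N) → EuclideanSpace ℝ (Fin N))
    (hρ : IsProbDensity ρ) (hH1 : HypothesisH1 ρ ρ')
    (R₁ : ℝ) (hR₁ : 0 < R₁)
    (hdrift : ∀ ε : ℝ, 0 < ε → ∃ Cε : ℝ, 0 < Cε ∧
      ∀ᵐ x ∂(volume.restrict (Metric.ball (0 : EuclideanSpace ℝ (Fin N)) R₁)),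
        ‖(ρ x)⁻¹ • ρ' x‖ ^ 2 ≤ ε / ‖x‖ ^ 2 + Cε) :
    (hardyConst N - 1) ^ 2 = ((N : ℝ) * ((N : ℝ) - 4) / 4) ^ 2 ∧
      ∀ c : ℝ, (hardyConst N - 1) ^ 2 < c → ¬ WeightedRellich 𝕜 ρ ρ' c := by
  rw [hardyConst_sub_one_eq]
  refine ⟨rfl, fun c hc ⟨C, hC, hR⟩ => ?_⟩
  have hN' : (5 : ℝ) ≤ N := by exact_mod_cast hN
  have hA : 0 ≤ rellichRoot N := by
    rw [rellichRoot]
    have : (0 : ℝ) ≤ N - 4 := by linarith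
    positivity
  have hα : |rellichExponent N| ≤ N := by
    rw [rellichExponent, abs_le]
    constructor <;> linarith
  -- The order of choices matters: `δ` depends on `c` and `C`, `η` on `δ`, `b` on `η` and `δ`, and
  -- only then is `f` built for the measure at hand.
  obtain ⟨δ, hδ, hδ1, hlt⟩ := exists_small_perturbation_lt (n := N) (C := C) hc
  obtain ⟨η, hη, hηδ, htest⟩ := exists_test_function_small_derivatives (pow_pos hδ 2)
  replace hηδ : η ≤ δ := hηδ.trans (pow_le_of_le_one hδ.le hδ1 two_ne_zero)
  obtain ⟨b, hb, hbδ, hB⟩ := exists_norm_mul_norm_le_of_drift hR₁ hdrift hη hδ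
  have := hρ.isFiniteMeasure
  have := isOpenPosMeasure_logMeasure (by omega) hH1.volume_absolutelyContinuous
  have hslow : SlowlyVarying (logMeasure (weightMeasure ρ)) η b := by
    refine hρ.slowlyVarying_logMeasure hH1.hasWeakGradient hb ?_
    filter_upwards [hB, hH1.ae_pos] with x hx hpos hxb
    have h1 := hx hxb
    rw [norm_smul, norm_inv, Real.norm_eq_abs, abs_of_pos hpos, mul_left_comm,
      inv_mul_le_iff₀ hpos] at h1
    linarith
  obtain ⟨f, a, hf, ⟨t, ht⟩, hsmall⟩ := htest _ b hslow
  have hX : 0 < ∫ t, f t ^ 2 ∂(logMeasure (weightMeasure ρ)) := by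
    refine (hf.contDiff.continuous.pow 2).integral_pos_of_hasCompactSupport_nonneg_nonzero ?_
      (fun t => sq_nonneg _) (x := t) (pow_ne_zero 2 ht)
    exact HasCompactSupport.intro (isCompact_Icc (a := a) (b := b))
      fun t ht => by simp [hf.eq_zero t ht]
  have h1 := rellich_inequality_logMeasure hρ hH1 hf hb
    ((withDensity_absolutelyContinuous _ _).ae_le hB) ((sq_nonneg _).trans hc.le) hC.le hR
  have h2 := integral_rellich_le hf hA hα hδ hδ1 hη.le hηδ hC.le hb hbδ hsmall
  exact absurd (h1.trans h2) (not_le.2 (mul_lt_mul_of_pos_right hlt hX))
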